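/- Let $P$ be a non-empty set of propositional atoms and $A$ a non-empty finite set of agents. **Action models and their logic.** The language $\mathcal L$ of modal logic is $\phi ::= p \mid \neg\phi \mid \phi\wedge\phi \mid \Box_a\phi$ ($p \in P$, $a \in A$), and $\vdash_{\mathbf{S5}}$ denotes provability in multi-agent $\mathbf{S5}$. The language $\mathcal L_{AAML}$ is $$\phi ::= p \mid \neg\phi \mid \phi\wedge\phi \mid \Box_a\phi \mid [\mathsf M_{\mathsf T}]\phi \mid \forall\phi,$$ where $\mathsf M_{\mathsf T}$ is an S5 action model: a finite non-empty set of points with an equivalence relation $\mathsf R_a$ for each agent $a$, a precondition $\mathsf{pre}(\mathsf t)\in\mathcal L_{AAML}$ for each point $\mathsf t$, and a set $\mathsf T$ of designated points; $\forall$ is the refinement quantifier. We use the usual abbreviations, $\Diamond_a\phi=\neg\Box_a\neg\phi$, $\langle\mathsf M_{\mathsf T}\rangle\phi=\neg[\mathsf M_{\mathsf T}]\neg\phi$, $\exists\phi=\neg\forall\neg\phi$, and $\nabla_a\Gamma=\Box_a\bigvee_{\gamma\in\Gamma}\gamma\wedge\bigwedge_{\gamma\in\Gamma}\Diamond_a\gamma$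 for finite $\Gamma\subseteq\mathcal L$. The sequential execution $\mathsf M_{\mathsf T}\otimes\mathsf M'_{\mathsf T'}$ has as points the pairs $(\mathsf s,\mathsf s')$, componentwise accessibility, preconditions $\langle\mathsf M_{\mathsf s}\rangle\mathsf{pre}'(\mathsf s')$ and designated points $\mathsf T\times\mathsf T'$. Let $B\subseteq A$, $\gamma^0\in\mathcal L$, and $\Gamma_a\subseteq\mathcal L$ finite with $\gamma^0\in\Gamma_a$ for $a\in B$; let $\Psi$ be the set of all subformulae of members of $\bigcup_{a\in B}\Gamma_a$. Call $\gamma^0\wedge\bigwedge_{a\in B}\nabla_a\Gamma_a$ *explicit* if for all $a\in B$ and $\gamma\in\Gamma_a$: (i) for every $\psi\in\Psi$, $\vdash_{\mathbf{S5}}\gamma\to\psi$ or $\vdash_{\mathbf{S5}}\gamma\to\neg\psi$; (ii) for every $\Box_a\psi\in\Psi$, $\vdash_{\mathbf{S5}}\gamma\to\Box_a\psi$ if and only if $\vdash_{\mathbf{S5}}\gamma'\to\psi$ for all $\gamma'\in\Gamma_a$. Provability $\vdash$ on $\mathcal L_{AAML}$ is given by: all instances of propositional tautologies; the axioms K, T,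 4, 5 for each $\Box_a$; modus ponens; necessitation for each $\Box_a$, each $[\mathsf M_{\mathsf T}]$ and $\forall$; and the axioms - $[\mathsf M_{\mathsf T}\otimes\mathsf M'_{\mathsf T'}]\phi\leftrightarrow[\mathsf M_{\mathsf T}][\mathsf M'_{\mathsf T'}]\phi$ and $[\mathsf M_{\mathsf T}]\phi\leftrightarrow\bigwedge_{\mathsf t\in\mathsf T}[\mathsf M_{\mathsf t}]\phi$; - $[\mathsf M_{\mathsf t}]p\leftrightarrow(\mathsf{pre}(\mathsf t)\to p)$ and $[\mathsf M_{\mathsf t}]\neg\phi\leftrightarrow(\mathsf{pre}(\mathsf t)\to\neg[\mathsf M_{\mathsf t}]\phi)$; - $[\mathsf M_{\mathsf t}](\phi\wedge\psi)\leftrightarrow([\mathsf M_{\mathsf t}]\phi\wedge[\mathsf M_{\mathsf t}]\psi)$; - $[\mathsf M_{\mathsf t}]\Box_a\phi\leftrightarrow(\mathsf{pre}(\mathsf t)\to\Box_a[\mathsf M_{\mathsf t\mathsf R_a}]\phi)$, where $\mathsf t\mathsf R_a=\{\mathsf u\mid\mathsf t\,\mathsf R_a\,\mathsf u\}$; - $\forall(\phi\to\psi)\to(\forall\phi\to\forall\psi)$,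 and $\forall\pi\leftrightarrow\pi$ for propositional $\pi$; - $\exists(\gamma^0\wedge\nabla_a\Gamma_a)\leftrightarrow\exists\gamma^0\wedge\bigwedge_{\gamma\in\Gamma_a}\Diamond_a\exists\gamma$ if $\gamma^0\wedge\nabla_a\Gamma_a$ is explicit ($B=\{a\}$); - $\exists(\gamma^0\wedge\bigwedge_{a\in A}\nabla_a\Gamma_a)\leftrightarrow\bigwedge_{a\in A}\exists(\gamma^0\wedge\nabla_a\Gamma_a)$ if $\gamma^0\wedge\bigwedge_{a\in A}\nabla_a\Gamma_a$ is explicit ($B=A$). **Action formulae.** The languages $\mathcal L_{AFL}$ of action formula logic and $\mathcal L_{AFL}^{act}$ of action formulae are defined simultaneously by $$\phi ::= p \mid \neg\phi \mid \phi\wedge\phi \mid \Box_a\phi \mid [\alpha]\phi,\qquad \alpha ::= {?\phi} \mid \alpha\sqcup\alpha \mid \alpha\otimes\alpha \mid L_B(\alpha,\alpha)\quad(\emptyset\ne B\subseteq A),$$ with $\langle\alpha\rangle\phi=\neg[\alpha]\neg\phi$. Each action formula $\alpha$ stands for an S5 action model $\tau(\alpha)$: - $\tau(?\phi)$ has a designated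 point with precondition $\phi$ and a further point with precondition $\top$, and no agent distinguishes the two; - $\tau(\alpha\sqcup\beta)$ is the disjoint union of $\tau(\alpha)$ and $\tau(\beta)$, and $\tau(\alpha\otimes\beta)$ is their sequential execution; - $\tau(L_B(\alpha,\beta))$ is obtained from the disjoint union of $\tau(\alpha)$ and $\tau(\beta)$ by adding, for each designated point $\mathsf t$ of either, a new proxy point $\bar{\mathsf t}$ with the precondition of $\mathsf t$; for $a\in B$ all proxies form one new $a$-class, for $a\notin B$ each $\bar{\mathsf t}$ joins the $a$-class of $\mathsf t$; the designated points are the proxies of the designated points of $\tau(\alpha)$. A formula that contains action formulae is called provable if the $\mathcal L_{AAML}$-formula that results from replacing each action formula $\alpha$ in it by $\tau(\alpha)$ is provable. **Proposition.** For every $\phi\in\mathcal L_{AFL}$ there is an action formula $\alpha\in\mathcal L_{AFL}^{act}$ such that $$\vdash[\alpha]\phi\qquad\text{and}\qquad\vdash\exists\phi\to\langle\alpha\rangle\phi.$$ -/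

import Mathlib

universe u v

namespace AFL

/-! ## The modal language and the axiomatisation of S5 -/

/-- The language of (multi-agent) modal logic over atoms `P` and agents `A`. -/
inductive ModalForm (P : Type u) (A : Type v) : Type (max u v)
  | atom (p : P) : ModalForm P A
  | neg (φ : ModalForm P A) : ModalForm P A
  | and (φ ψ : ModalForm P A) : ModalForm P A
  | box (a : A) (φ : ModalForm P A) : ModalForm P A

namespace ModalForm

variable {P : Type u} {A : Type v}

/-- Implication, as the usual abbreviation. -/
def imp (φ ψ : ModalForm P A) : ModalForm P A := neg (and φ (neg ψ))

/-- Instances of propositional tautologies: formulae that hold under every assignment of truth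
values to all formulae that respects negation and conjunction. -/
def Taut (χ : ModalForm P A) : Prop :=
  ∀ v : ModalForm P A → Prop, (∀ φ, v (neg φ) ↔ ¬ v φ) →
    (∀ φ ψ, v (and φ ψ) ↔ (v φ ∧ v ψ)) → v χ

/-- Provability in the axiomatisation of S5. -/
inductive ProvesS5 : ModalForm P A → Prop
  | taut {φ} : Taut φ → ProvesS5 φ
  | axK (a : A) (φ ψ) : ProvesS5 ((box a (φ.imp ψ)).imp ((box a φ).imp (box a ψ)))
  | axT (a : A) (φ) : ProvesS5 ((box a φ).imp φ)
  | ax4 (a : A) (φ) : ProvesS5 ((box a φ).imp (box a (box a φ)))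
  | ax5 (a : A) (φ) : ProvesS5 ((neg (box a φ)).imp (box a (neg (box a φ))))
  | mp {φ ψ} : ProvesS5 (φ.imp ψ) → ProvesS5 φ → ProvesS5 ψ
  | nec (a : A) {φ} : ProvesS5 φ → ProvesS5 (box a φ)

/-- The set of subformulae of a formula (including the formula itself). -/
def subs : ModalForm P A → Set (ModalForm P A)
  | atom p => {atom p}
  | neg φ => insert (neg φ) φ.subs
  | and φ ψ => insert (and φ ψ) (φ.subs ∪ ψ.subs)
  | box a φ => insert (box a φ) φ.subs

/-- The condition for `π ∧ γ₀ ∧ ⋀_{a ∈ B} ∇_a (Γ a)`, with `π` any propositional formula, to be an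
explicit formula with respect to the agents in `B`. Here `Ψ` is the set of all subformulae of
members of the sets `Γ a`, `a ∈ B`. -/
def Explicit (B : Set A) (γ₀ : ModalForm P A) (Γ : A → Finset (ModalForm P A)) : Prop :=
  let Ψ : Set (ModalForm P A) := {ψ | ∃ a ∈ B, ∃ γ ∈ Γ a, ψ ∈ γ.subs}
  (∀ a ∈ B, γ₀ ∈ Γ a) ∧
  (∀ a ∈ B, ∀ γ ∈ Γ a, ∀ ψ ∈ Ψ, ProvesS5 (γ.imp ψ) ∨ ProvesS5 (γ.imp (neg ψ))) ∧
  (∀ a ∈ B, ∀ γ ∈ Γ a, ∀ ψ, box a ψ ∈ Ψ →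
    (ProvesS5 (γ.imp (box a ψ)) ↔ ∀ γ' ∈ Γ a, ProvesS5 (γ'.imp ψ)))

end ModalForm

/-! ## Arbitrary action model logic over S5 -/

/-- The frame of an S5 action model: a finite non-empty set of action points with one equivalence
relation for each agent. -/
structure ActFrame (A : Type v) : Type (max v 1) where
  pt : Type
  finite : Finite pt
  nonempty : Nonempty pt
  rel : A → pt → pt → Prop
  equiv : ∀ a, Equivalence (rel a)

/-- The language of arbitrary action model logic, restricted to S5 action models. In `act F pre T φ`
the action model has frame `F`, preconditions `pre` and designated points `T`; the formula is
`[(F, pre)_T] φ`. The last constructor is the universal refinement quantifier. -/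
inductive Form (P : Type u) (A : Type v) : Type (max u v 1)
  | atom (p : P) : Form P A
  | neg (φ : Form P A) : Form P A
  | and (φ ψ : Form P A) : Form P A
  | box (a : A) (φ : Form P A) : Form P A
  | act (F : ActFrame A) (pre : F.pt → Form P A) (T : Set F.pt) (φ : Form P A) : Form P A
  | allRef (φ : Form P A) : Form P A

/-- A multi-pointed S5 action model with preconditions in the language `Form P A`. -/
structure ActModel (P : Type u) (A : Type v) : Type (max u v 1) where
  frame : ActFrame A
  pre : frame.pt → Form P A
  pts : Set frame.pt

namespace Form

variable {P : Type u} {A : Type v}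

def imp (φ ψ : Form P A) : Form P A := neg (and φ (neg ψ))

def or (φ ψ : Form P A) : Form P A := neg (and (neg φ) (neg ψ))

def iff (φ ψ : Form P A) : Form P A := and (imp φ ψ) (imp ψ φ)

def dia (a : A) (φ : Form P A) : Form P A := neg (box a (neg φ))

/-- The existential refinement quantifier. -/
def someRef (φ : Form P A) : Form P A := neg (allRef (neg φ))

noncomputable def top [Nonempty P] : Form P A :=
  or (atom (Classical.arbitrary P)) (neg (atom (Classical.arbitrary P)))

noncomputable def bot [Nonempty P] : Form P A := neg top

/-- The conjunction of `f i` for `i` in a finite set. -/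
noncomputable def bigAnd [Nonempty P] {ι : Type*} (s : Finset ι) (f : ι → Form P A) : Form P A :=
  (s.toList.map f).foldr and top

/-- The disjunction of `f i` for `i` in a finite set. -/
noncomputable def bigOr [Nonempty P] {ι : Type*} (s : Finset ι) (f : ι → Form P A) : Form P A :=
  (s.toList.map f).foldr or bot

/-- `[M] φ` for a multi-pointed action model `M`. -/
def allAct (M : ActModel P A) (φ : Form P A) : Form P A := act M.frame M.pre M.pts φ

/-- `⟨M⟩ φ` for a multi-pointed action model `M`. -/
def someAct (M : ActModel P A) (φ : Form P A) : Form P A := neg (allAct M (neg φ))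

/-- The formulae of propositional logic. -/
def IsProp : Form P A → Prop
  | atom _ => True
  | neg φ => φ.IsProp
  | and φ ψ => φ.IsProp ∧ ψ.IsProp
  | _ => False

/-- The inclusion of the modal language. -/
def ofModal : ModalForm P A → Form P A
  | .atom p => atom p
  | .neg φ => neg (ofModal φ)
  | .and φ ψ => and (ofModal φ) (ofModal ψ)
  | .box a φ => box a (ofModal φ)

/-- The cover operator `∇_a Γ` for a finite set `Γ` of modal formulae. -/
noncomputable def cover [Nonempty P] (a : A) (Γ : Finset (ModalForm P A)) : Form P A :=
  and (box a (bigOr Γ ofModal)) (bigAnd Γ fun γ => dia a (ofModal γ))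

/-- Instances of propositional tautologies. -/
def Taut (χ : Form P A) : Prop :=
  ∀ v : Form P A → Prop, (∀ φ, v (neg φ) ↔ ¬ v φ) →
    (∀ φ ψ, v (and φ ψ) ↔ (v φ ∧ v ψ)) → v χ

end Form

namespace ActModel

variable {P : Type u} {A : Type v}

/-- The same action model with designated points `T`. -/
def withPts (M : ActModel P A) (T : Set M.frame.pt) : ActModel P A := ⟨M.frame, M.pre, T⟩

/-- Sequential execution of action models: first `M`, then `N`. -/
def seq (M N : ActModel P A) : ActModel P A where
  frame :=
    { pt := M.frame.pt × N.frame.pt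
      finite := by
        have := M.frame.finite
        have := N.frame.finite
        infer_instance
      nonempty := by
        have := M.frame.nonempty
        have := N.frame.nonempty
        infer_instance
      rel := fun a x y => M.frame.rel a x.1 y.1 ∧ N.frame.rel a x.2 y.2
      equiv := fun a =>
        ⟨fun x => ⟨(M.frame.equiv a).refl x.1, (N.frame.equiv a).refl x.2⟩,
         fun h => ⟨(M.frame.equiv a).symm h.1, (N.frame.equiv a).symm h.2⟩,
         fun h k => ⟨(M.frame.equiv a).trans h.1 k.1, (N.frame.equiv a).trans h.2 k.2⟩⟩ }
  pre := fun x => Form.someAct (M.withPts {x.1}) (N.pre x.2)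
  pts := M.pts ×ˢ N.pts

/-- The action model of a test: points `true` (test) and `false` (skip), which no agent can
tell apart. -/
noncomputable def test [Nonempty P] (φ : Form P A) : ActModel P A where
  frame :=
    { pt := Bool
      finite := inferInstance
      nonempty := inferInstance
      rel := fun _ _ _ => True
      equiv := fun _ => ⟨fun _ => trivial, fun _ => trivial, fun _ _ => trivial⟩ }
  pre := fun x => if x then φ else Form.top
  pts := {true}

/-- The action model of a non-deterministic choice: the disjoint union. -/
def choice (M N : ActModel P A) : ActModel P A where
  frame :=
    { pt := M.frame.pt ⊕ N.frame.pt
      finite := by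
        have := M.frame.finite
        have := N.frame.finite
        infer_instance
      nonempty := by
        have := M.frame.nonempty
        infer_instance
      rel := fun a => Sum.LiftRel (M.frame.rel a) (N.frame.rel a)
      equiv := fun a => by
        refine ⟨?_, ?_, ?_⟩
        · rintro (x | x)
          · exact .inl ((M.frame.equiv a).refl x)
          · exact .inr ((N.frame.equiv a).refl x)
        · rintro _ _ (h | h)
          · exact .inl ((M.frame.equiv a).symm h)
          · exact .inr ((N.frame.equiv a).symm h)
        · rintro _ _ _ (h | h) (k | k)
          · exact .inl ((M.frame.equiv a).trans h k)
          · exact .inr ((N.frame.equiv a).trans h k) }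
  pre := Sum.elim M.pre N.pre
  pts := Sum.inl '' M.pts ∪ Sum.inr '' N.pts

/-- The points of the action model of learning: all points of `U`, and a new proxy point for each
designated point of `U`. -/
abbrev LearnPt (U : ActModel P A) : Type := U.frame.pt ⊕ {t : U.frame.pt // t ∈ U.pts}

/-- A point of `U` is sent to itself and a proxy to the point that it is the proxy of. -/
def LearnPt.base {U : ActModel P A} : LearnPt U → U.frame.pt := Sum.elim id Subtype.val

/-- The accessibility relations of the action model of learning. For an agent in `B`, all proxies
are related to each other, and to nothing else. For an agent outside `B`, the proxy of `t` joins
the equivalence class of `t`. The relations between points of `U` do not change. -/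
def LearnRel (B : Set A) (U : ActModel P A) (a : A) (x y : LearnPt U) : Prop :=
  (a ∈ B ∧ Sum.LiftRel (U.frame.rel a) (fun _ _ => True) x y) ∨
  (a ∉ B ∧ U.frame.rel a x.base y.base)

theorem learnRel_equiv (B : Set A) (U : ActModel P A) (a : A) :
    Equivalence (LearnRel B U a) := by
  have e := U.frame.equiv a
  refine ⟨?_, ?_, ?_⟩
  · intro x
    by_cases h : a ∈ B
    · refine .inl ⟨h, ?_⟩
      rcases x with x | x
      · exact .inl (e.refl x)
      · exact .inr trivial
    · exact .inr ⟨h, e.refl _⟩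
  · rintro x y (⟨h, k⟩ | ⟨h, k⟩)
    · refine .inl ⟨h, ?_⟩
      rcases k with k | k
      · exact .inl (e.symm k)
      · exact .inr trivial
    · exact .inr ⟨h, e.symm k⟩
  · rintro x y z (⟨h, k⟩ | ⟨h, k⟩) (⟨h', l⟩ | ⟨h', l⟩)
    · refine .inl ⟨h, ?_⟩
      rcases k with k | k <;> rcases l with l | l
      · exact .inl (e.trans k l)
      · exact .inr trivial
    · exact absurd h h'
    · exact absurd h' h
    · exact .inr ⟨h, e.trans k l⟩

/-- The action model of the agents in `B` learning that `M` or `N` occurred, when in fact `M`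
occurred. Its points are those of the disjoint union of `M` and `N` together with the proxies of
all designated points of `M` and `N`; its designated points are the proxies of those of `M`. -/
def learn (B : Set A) (M N : ActModel P A) : ActModel P A where
  frame :=
    { pt := LearnPt (M.choice N)
      finite := by
        have := (M.choice N).frame.finite
        infer_instance
      nonempty := by
        have := (M.choice N).frame.nonempty
        infer_instance
      rel := LearnRel B (M.choice N)
      equiv := learnRel_equiv B (M.choice N) }
  pre := fun x => (M.choice N).pre x.base
  pts := {x | ∃ (t : M.frame.pt) (ht : t ∈ M.pts),
    x = Sum.inr ⟨Sum.inl t, Or.inl (Set.mem_image_of_mem Sum.inl ht)⟩}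

/-- The designated points of an action model as a `Finset`. -/
noncomputable def ptsFinset (M : ActModel P A) : Finset M.frame.pt :=
  haveI := M.frame.finite
  (Set.toFinite M.pts).toFinset

end ActModel

open Form in
/-- Provability in the axiomatisation of arbitrary action model logic over S5: the axioms and rules
of S5, the reduction axioms and necessitation for action models, and the axioms and necessitation
for refinement quantifiers. -/
inductive Provable {P : Type u} {A : Type v} [Nonempty P] [Fintype A] : Form P A → Prop
  | taut {φ : Form P A} : Taut φ → Provable φ
  | axK (a : A) (φ ψ : Form P A) :
      Provable (imp (box a (imp φ ψ)) (imp (box a φ) (box a ψ)))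
  | axT (a : A) (φ : Form P A) : Provable (imp (box a φ) φ)
  | ax4 (a : A) (φ : Form P A) : Provable (imp (box a φ) (box a (box a φ)))
  | ax5 (a : A) (φ : Form P A) : Provable (imp (neg (box a φ)) (box a (neg (box a φ))))
  | mp {φ ψ : Form P A} : Provable (imp φ ψ) → Provable φ → Provable ψ
  | nec (a : A) {φ : Form P A} : Provable φ → Provable (box a φ)
  | axAS (M N : ActModel P A) (φ : Form P A) :
      Provable (iff (allAct (M.seq N) φ) (allAct M (allAct N φ)))
  | axAU (M : ActModel P A) (φ : Form P A) :
      Provable (iff (allAct M φ) (bigAnd M.ptsFinset fun t => allAct (M.withPts {t}) φ))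
  | axAP (M : ActModel P A) (t : M.frame.pt) (p : P) :
      Provable (iff (allAct (M.withPts {t}) (atom p)) (imp (M.pre t) (atom p)))
  | axAN (M : ActModel P A) (t : M.frame.pt) (φ : Form P A) :
      Provable (iff (allAct (M.withPts {t}) (neg φ))
        (imp (M.pre t) (neg (allAct (M.withPts {t}) φ))))
  | axAC (M : ActModel P A) (t : M.frame.pt) (φ ψ : Form P A) :
      Provable (iff (allAct (M.withPts {t}) (and φ ψ))
        (and (allAct (M.withPts {t}) φ) (allAct (M.withPts {t}) ψ)))
  | axAK (M : ActModel P A) (t : M.frame.pt) (a : A) (φ : Form P A) :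
      Provable (iff (allAct (M.withPts {t}) (box a φ))
        (imp (M.pre t) (box a (allAct (M.withPts {u | M.frame.rel a t u}) φ))))
  | necA (M : ActModel P A) {φ : Form P A} : Provable φ → Provable (allAct M φ)
  | axR (φ ψ : Form P A) :
      Provable (imp (allRef (imp φ ψ)) (imp (allRef φ) (allRef ψ)))
  | axRP {π : Form P A} : IsProp π → Provable (iff (allRef π) π)
  | axRS5 (a : A) (γ₀ : ModalForm P A) (Γ : A → Finset (ModalForm P A)) :
      ModalForm.Explicit {a} γ₀ Γ →
      Provable (iff (someRef (and (ofModal γ₀) (cover a (Γ a))))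
        (and (someRef (ofModal γ₀)) (bigAnd (Γ a) fun γ => dia a (someRef (ofModal γ)))))
  | axRDist (γ₀ : ModalForm P A) (Γ : A → Finset (ModalForm P A)) :
      ModalForm.Explicit Set.univ γ₀ Γ →
      Provable (iff
        (someRef (and (ofModal γ₀) (bigAnd Finset.univ fun a => cover a (Γ a))))
        (bigAnd Finset.univ fun a => someRef (and (ofModal γ₀) (cover a (Γ a)))))
  | necR {φ : Form P A} : Provable φ → Provable (allRef φ)

/-! ## Arbitrary action formula logic -/

mutual

/-- The language of arbitrary action formula logic. -/
inductive AFForm (P : Type u) (A : Type v) : Type (max u v)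
  | atom (p : P) : AFForm P A
  | neg (φ : AFForm P A) : AFForm P A
  | and (φ ψ : AFForm P A) : AFForm P A
  | box (a : A) (φ : AFForm P A) : AFForm P A
  | allAct (α : AFAct P A) (φ : AFForm P A) : AFForm P A
  | allRef (φ : AFForm P A) : AFForm P A

/-- The language of arbitrary action formulae: tests, non-deterministic choice, sequential
execution, and learning by a non-empty set of agents. -/
inductive AFAct (P : Type u) (A : Type v) : Type (max u v)
  | test (φ : AFForm P A) : AFAct P A
  | choice (α β : AFAct P A) : AFAct P A
  | seq (α β : AFAct P A) : AFAct P A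
  | learn (B : Set A) (hB : B.Nonempty) (α β : AFAct P A) : AFAct P A

end

section

variable {P : Type u} {A : Type v}

mutual

/-- The formulae of action formula logic: those without refinement quantifiers. -/
def AFForm.RefFree : AFForm P A → Prop
  | .atom _ => True
  | .neg φ => φ.RefFree
  | .and φ ψ => φ.RefFree ∧ ψ.RefFree
  | .box _ φ => φ.RefFree
  | .allAct α φ => α.RefFree ∧ φ.RefFree
  | .allRef _ => False

/-- The action formulae without refinement quantifiers. -/
def AFAct.RefFree : AFAct P A → Prop
  | .test φ => φ.RefFree
  | .choice α β => α.RefFree ∧ β.RefFree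
  | .seq α β => α.RefFree ∧ β.RefFree
  | .learn _ _ α β => α.RefFree ∧ β.RefFree

end

mutual

/-- The translation of formulae that replaces each action formula by its S5 action model. -/
noncomputable def AFForm.toForm [Nonempty P] : AFForm P A → Form P A
  | .atom p => .atom p
  | .neg φ => .neg φ.toForm
  | .and φ ψ => .and φ.toForm ψ.toForm
  | .box a φ => .box a φ.toForm
  | .allAct α φ => Form.allAct α.toModel φ.toForm
  | .allRef φ => .allRef φ.toForm

/-- The S5 action model that an action formula stands for. -/
noncomputable def AFAct.toModel [Nonempty P] : AFAct P A → ActModel P A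
  | .test φ => ActModel.test φ.toForm
  | .choice α β => ActModel.choice α.toModel β.toModel
  | .seq α β => ActModel.seq α.toModel β.toModel
  | .learn B _ α β => ActModel.learn B α.toModel β.toModel

end

namespace AFForm

def imp (φ ψ : AFForm P A) : AFForm P A := neg (and φ (neg ψ))

/-- `⟨α⟩ φ`. -/
def someAct (α : AFAct P A) (φ : AFForm P A) : AFForm P A := neg (allAct α (neg φ))

/-- The existential refinement quantifier. -/
def someRef (φ : AFForm P A) : AFForm P A := neg (allRef (neg φ))

/-- Provability in S5 of a formula of arbitrary action formula logic: provability in arbitrary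
action model logic over S5, reading each action formula as its action model. -/
def Proves [Nonempty P] [Fintype A] (φ : AFForm P A) : Prop := Provable φ.toForm

end AFForm

end

end AFL

-- Up to logical equivalence a formula without refinement quantifiers is a modal formula, and a
-- modal formula of depth at most `k` over a finite set `Q` of atoms is a disjunction of
-- characteristic formulae of the finitely many depth-`k` types. Since `∃` distributes over
-- disjunction, it suffices to synthesise, for each type `τ` realised in an S5 model, an action
-- formula all of whose results have type `τ` and which can be executed wherever `∃` of the
-- characteristic formula holds. The required `α` is the choice of these over all types that satisfy
-- `φ` (`exists_action`).
--
-- Synthesis goes by induction on depth. For a type of depth `k + 1`, start from the action for its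
-- depth-`k` part and prescribe the classes of the agents one by one (`exists_learn`). To give agent
-- `b` the class `S`, let `b` learn that either the current action or one of the actions for the
-- members of `S` took place. Both alternatives are guarded by a test that every member of `S` can
-- be produced at some world that `b` cannot distinguish from the actual one. The proxies then
-- present exactly the types in `S` to `b`, while depth-`k` types and the classes of the other
-- agents stay the same (`ty_learn`, `post_learn`).
--
-- Only the refinement quantifier needs syntactic work. Characteristic formulae of realised types
-- are explicit (`explicit_chr`), so the two cover axioms turn `∃` of such a formula into diamonds
-- of `∃` of formulae of smaller depth, to which the induction hypothesis applies
-- (`provable_someRef_chr_succ`). Everything else is a semantic fact about refinement-free formulae,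
-- which is provable because such formulae reduce to modal ones and S5 is complete
-- (`Provable.of_valid`).

namespace AFL

/-! ## Kripke semantics of the modal language, and completeness of S5 -/

/-- Kripke models with equivalence relations. -/
structure Model (P : Type u) (A : Type v) : Type (max u v + 1) where
  W : Type (max u v)
  R : A → W → W → Prop
  equiv : ∀ a, Equivalence (R a)
  V : P → W → Prop

namespace ModalForm

variable {P : Type u} {A : Type v}

/-- Satisfaction of modal formulae. -/
def Sat : ModalForm P A → (K : Model P A) → K.W → Prop
  | atom p, K, s => K.V p s
  | neg φ, K, s => ¬ φ.Sat K s
  | and φ ψ, K, s => φ.Sat K s ∧ ψ.Sat K s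
  | box a φ, K, s => ∀ s', K.R a s s' → φ.Sat K s'

/-- Validity in all Kripke models with equivalence relations. -/
def Valid (φ : ModalForm P A) : Prop := ∀ (K : Model P A) (s : K.W), φ.Sat K s

theorem sat_imp {φ ψ : ModalForm P A} {K : Model P A} {s : K.W} :
    (imp φ ψ).Sat K s ↔ (φ.Sat K s → ψ.Sat K s) := by
  simp [imp, Sat]

theorem ProvesS5.sound {φ : ModalForm P A} (h : ProvesS5 φ) : φ.Valid := by
  intro K s
  induction h generalizing s with
  | taut h => exact h (fun ψ => ψ.Sat K s) (fun _ => Iff.rfl) (fun _ _ => Iff.rfl)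
  | axK a φ ψ =>
    simp only [sat_imp, Sat]
    exact fun h k s' r => h s' r (k s' r)
  | axT a φ =>
    simp only [sat_imp, Sat]
    exact fun h => h s ((K.equiv a).refl s)
  | ax4 a φ =>
    simp only [sat_imp, Sat]
    exact fun h s' r s'' r' => h s'' ((K.equiv a).trans r r')
  | ax5 a φ =>
    simp only [sat_imp, Sat]
    exact fun h s' r k => h fun s'' r' => k s'' ((K.equiv a).trans ((K.equiv a).symm r) r')
  | mp _ _ h k => exact sat_imp.1 (h s) (k s)
  | nec a _ h => exact fun s' _ => h s'

/-- Assignments of truth values that respect negation and conjunction. -/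
def Respects (v : ModalForm P A → Prop) : Prop :=
  (∀ φ, v (neg φ) ↔ ¬ v φ) ∧ ∀ φ ψ, v (and φ ψ) ↔ (v φ ∧ v ψ)

theorem Respects.imp {v : ModalForm P A → Prop} (h : Respects v) (φ ψ : ModalForm P A) :
    v (φ.imp ψ) ↔ (v φ → v ψ) := by
  simp [ModalForm.imp, h.1, h.2]

/-- The formula `l₁ → ⋯ → lₙ → φ`. -/
def impList (l : List (ModalForm P A)) (φ : ModalForm P A) : ModalForm P A := l.foldr imp φ

theorem Respects.impList {v : ModalForm P A → Prop} (h : Respects v)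
    (l : List (ModalForm P A)) (φ : ModalForm P A) :
    v (impList l φ) ↔ ((∀ ψ ∈ l, v ψ) → v φ) := by
  induction l with
  | nil => simp [ModalForm.impList]
  | cons ψ l ih =>
    have : v (ModalForm.impList (ψ :: l) φ) ↔ (v ψ → v (ModalForm.impList l φ)) := h.imp _ _
    simp [this, ih]

/-- Compactness of propositional logic. -/
theorem exists_respects (T : Set (ModalForm P A)) (φ : ModalForm P A)
    (h : ∀ l : List (ModalForm P A), (∀ ψ ∈ l, ψ ∈ T) → ¬ Taut (impList l φ)) :
    ∃ v : ModalForm P A → Prop, Respects v ∧ (∀ ψ ∈ T, v ψ) ∧ ¬ v φ := by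
  classical
  -- Assignments are points of a compact product of two-point spaces. Each requirement involves
  -- finitely many coordinates and so is closed. A non-tautology `impList l φ` supplies a point
  -- meeting finitely many of them.
  let X := ModalForm P A → Bool
  let C₀ : Set X :=
    {v | (∀ χ, v (neg χ) = !v χ) ∧ (∀ χ χ', v (and χ χ') = (v χ && v χ')) ∧ v φ = false}
  have closed₀ : IsClosed C₀ := by
    have hC : C₀ = (⋂ χ, {v : X | v (neg χ) = !v χ}) ∩
        ((⋂ χ, ⋂ χ', {v : X | v (and χ χ') = (v χ && v χ')}) ∩ {v : X | v φ = false}) := by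
      ext v
      simp [C₀]
    rw [hC]
    refine IsClosed.inter (isClosed_iInter fun χ => isClosed_eq (continuous_apply _) ?_)
      (IsClosed.inter (isClosed_iInter fun χ => isClosed_iInter fun χ' =>
        isClosed_eq (continuous_apply _) ?_) (isClosed_eq (continuous_apply _) continuous_const))
    · exact (continuous_of_discreteTopology (f := Bool.not)).comp (continuous_apply χ)
    · have hc : Continuous fun v : X => (v χ, v χ') :=
        (continuous_apply χ).prodMk (continuous_apply χ')
      exact (continuous_of_discreteTopology (f := fun x : Bool × Bool => x.1 && x.2)).comp hc
  have hne : (C₀ ∩ ⋂ ψ : T, {v : X | v ψ = true}).Nonempty := by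
    refine closed₀.isCompact.inter_iInter_nonempty (fun ψ : T => {v : X | v ψ = true})
      (fun ψ => isClosed_eq (continuous_apply _) continuous_const) ?_
    intro t
    have := h (t.toList.map Subtype.val) (by simp +contextual)
    simp only [Taut, not_forall] at this
    obtain ⟨v, hn, ha, hv⟩ := this
    rw [Respects.impList ⟨hn, ha⟩] at hv
    simp only [List.mem_map, Finset.mem_toList, Subtype.exists, not_forall] at hv
    obtain ⟨ht, hφ⟩ := hv
    refine ⟨fun χ => decide (v χ), ⟨?_, ?_, ?_⟩, ?_⟩
    · intro χ; simp [hn]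
    · intro χ χ'; simp [ha]
    · simpa using hφ
    · simp only [Set.mem_iInter, Set.mem_ofPred_eq, decide_eq_true_eq]
      exact fun ψ hψ => ht ψ ⟨ψ, ψ.2, hψ, rfl⟩
  obtain ⟨v, ⟨hn, ha, hφ⟩, hT⟩ := hne
  refine ⟨fun χ => v χ = true, ⟨fun χ => ?_, fun χ χ' => ?_⟩, fun ψ hψ => ?_, ?_⟩
  · simp [hn]
  · simp [ha]
  · exact Set.mem_iInter.1 hT ⟨ψ, hψ⟩
  · simp [hφ]

theorem ProvesS5.of_impList {l : List (ModalForm P A)} {φ : ModalForm P A}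
    (h : ProvesS5 (impList l φ)) (hl : ∀ ψ ∈ l, ProvesS5 ψ) : ProvesS5 φ := by
  induction l with
  | nil => exact h
  | cons ψ l ih =>
    exact ih (.mp h (hl ψ (by simp))) fun χ hχ => hl χ (by simp [hχ])

/-- The canonical model: worlds are the assignments that respect negation and conjunction and
make all theorems of S5 true. -/
def canonical (P : Type u) (A : Type v) : Model P A where
  W := {v : ModalForm P A → Prop // Respects v ∧ ∀ φ, ProvesS5 φ → v φ}
  R := fun a v w => ∀ φ, v.1 (box a φ) ↔ w.1 (box a φ)
  equiv := fun _ => ⟨fun _ _ => Iff.rfl, fun h φ => (h φ).symm, fun h k φ => (h φ).trans (k φ)⟩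
  V := fun p v => v.1 (atom p)

/-- Necessitation boxes the chain of implications, and axiom K then strips one premise at a time. -/
theorem canonical_box {a : A} (l : List (ModalForm P A)) {φ : ModalForm P A}
    (h : ProvesS5 (impList l φ)) (v : (canonical P A).W) (hl : ∀ ψ ∈ l, v.1 (box a ψ)) :
    v.1 (box a φ) := by
  have key : ∀ l : List (ModalForm P A), (∀ ψ ∈ l, v.1 (box a ψ)) →
      v.1 (box a (impList l φ)) → v.1 (box a φ) := by
    intro l
    induction l with
    | nil => exact fun _ h => h
    | cons ψ l ih =>
      intro hl h
      refine ih (fun χ hχ => hl χ (by simp [hχ])) ?_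
      have k := v.2.2 _ (ProvesS5.axK a ψ (impList l φ))
      rw [v.2.1.imp, v.2.1.imp] at k
      exact k h (hl ψ (by simp))
  exact key l hl (v.2.2 _ (.nec a h))

/-- The truth lemma. If a box fails at `v`, compactness gives an assignment that satisfies
everything boxed at `v` and refutes the body; it is a world because theorems are boxed at `v` by
necessitation. -/
theorem canonical_sat (φ : ModalForm P A) (v : (canonical P A).W) :
    φ.Sat (canonical P A) v ↔ v.1 φ := by
  induction φ generalizing v with
  | atom p => exact Iff.rfl
  | neg φ ih => rw [Sat, ih, v.2.1.1]
  | and φ ψ ih ih' => rw [Sat, ih, ih', v.2.1.2]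
  | box a φ ih =>
    constructor
    · intro h
      by_contra hv
      obtain ⟨w, hw, hT, hφ⟩ := exists_respects {ψ | v.1 (box a ψ)} φ fun l hl ht =>
        hv (canonical_box l (.taut ht) v hl)
      have mono : ∀ {χ χ' : ModalForm P A}, ProvesS5 (χ.imp χ') → v.1 χ → v.1 χ' :=
        fun hp => (v.2.1.imp _ _).1 (v.2.2 _ hp)
      refine hφ ((ih ⟨w, hw, fun χ hχ => hT χ (v.2.2 _ (.nec a hχ))⟩).1 (h _ fun ψ => ?_))
      -- Axiom 4 carries the true boxes of `v` over to `w`, and axiom 5 the false ones, so the two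
      -- agree on all boxes.
      refine ⟨fun k => hT _ (mono (.ax4 a ψ) k), fun k => ?_⟩
      by_contra k'
      exact (hw.1 _).1 (hT _ (mono (.ax5 a ψ) ((v.2.1.1 _).2 k'))) k
    · intro h w r
      rw [ih]
      exact (w.2.1.imp _ _).1 (w.2.2 _ (.axT a φ)) ((r φ).1 h)

theorem ProvesS5.complete {φ : ModalForm P A} (h : φ.Valid) : ProvesS5 φ := by
  by_contra hφ
  obtain ⟨v, hv, hT, k⟩ := exists_respects {ψ | ProvesS5 ψ} φ fun l hl ht =>
    hφ (ProvesS5.of_impList (.taut ht) hl)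
  exact k ((canonical_sat φ ⟨v, hv, hT⟩).1 (h _ _))

theorem provesS5_iff {φ : ModalForm P A} : ProvesS5 φ ↔ φ.Valid :=
  ⟨ProvesS5.sound, ProvesS5.complete⟩

end ModalForm

-- Derived connectives of the modal language.

namespace ModalForm

variable {P : Type u} {A : Type v}

def or (φ ψ : ModalForm P A) : ModalForm P A := neg (and (neg φ) (neg ψ))

def dia (a : A) (φ : ModalForm P A) : ModalForm P A := neg (box a (neg φ))

noncomputable def top [Nonempty P] : ModalForm P A :=
  or (atom (Classical.arbitrary P)) (neg (atom (Classical.arbitrary P)))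

noncomputable def bot [Nonempty P] : ModalForm P A := neg top

/-- The conjunction of `f i` for `i` in a finite set. -/
noncomputable def bigAnd [Nonempty P] {ι : Type*} (s : Finset ι) (f : ι → ModalForm P A) :
    ModalForm P A :=
  (s.toList.map f).foldr and top

/-- The disjunction of `f i` for `i` in a finite set. -/
noncomputable def bigOr [Nonempty P] {ι : Type*} (s : Finset ι) (f : ι → ModalForm P A) :
    ModalForm P A :=
  (s.toList.map f).foldr or bot

/-- The cover operator `∇_a Γ`. -/
noncomputable def cover [Nonempty P] (a : A) (Γ : Finset (ModalForm P A)) : ModalForm P A :=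
  and (box a (bigOr Γ id)) (bigAnd Γ fun γ => dia a γ)

theorem sat_or {φ ψ : ModalForm P A} {K : Model P A} {s : K.W} :
    (or φ ψ).Sat K s ↔ (φ.Sat K s ∨ ψ.Sat K s) := by
  simp only [or, Sat]
  tauto

theorem sat_dia {a : A} {φ : ModalForm P A} {K : Model P A} {s : K.W} :
    (dia a φ).Sat K s ↔ ∃ s', K.R a s s' ∧ φ.Sat K s' := by
  simp [dia, Sat]

theorem sat_top [Nonempty P] {K : Model P A} {s : K.W} : (top : ModalForm P A).Sat K s := by
  simp only [top, sat_or, Sat]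
  tauto

theorem sat_bigAnd [Nonempty P] {ι : Type*} {I : Finset ι} {f : ι → ModalForm P A}
    {K : Model P A} {s : K.W} : (bigAnd I f).Sat K s ↔ ∀ i ∈ I, (f i).Sat K s := by
  simp only [bigAnd, ← Finset.mem_toList (s := I)]
  induction I.toList with
  | nil => simp [sat_top]
  | cons i l ih => simp [Sat, ih]

theorem sat_bigOr [Nonempty P] {ι : Type*} {I : Finset ι} {f : ι → ModalForm P A}
    {K : Model P A} {s : K.W} : (bigOr I f).Sat K s ↔ ∃ i ∈ I, (f i).Sat K s := by
  simp only [bigOr, ← Finset.mem_toList (s := I)]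
  induction I.toList with
  | nil => simp [bot, Sat, sat_top]
  | cons i l ih => simp [sat_or, ih]

theorem sat_cover [Nonempty P] {a : A} {Γ : Finset (ModalForm P A)} {K : Model P A} {s : K.W} :
    (cover a Γ).Sat K s ↔ (∀ s', K.R a s s' → ∃ γ ∈ Γ, γ.Sat K s') ∧
      ∀ γ ∈ Γ, ∃ s', K.R a s s' ∧ γ.Sat K s' := by
  simp [cover, Sat, sat_bigAnd, sat_bigOr, sat_dia]

end ModalForm

/-! ## Reduction of formulae without refinement quantifiers to modal formulae -/

/-- The product update of a Kripke model. -/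
def Model.upd {P : Type u} {A : Type v} (K : Model P A) (F : ActFrame A)
    (pr : F.pt → K.W → Prop) : Model P A where
  W := {x : K.W × F.pt // pr x.2 x.1}
  R := fun a x y => K.R a x.1.1 y.1.1 ∧ F.rel a x.1.2 y.1.2
  equiv := fun a =>
    ⟨fun x => ⟨(K.equiv a).refl x.1.1, (F.equiv a).refl x.1.2⟩,
     fun h => ⟨(K.equiv a).symm h.1, (F.equiv a).symm h.2⟩,
     fun h k => ⟨(K.equiv a).trans h.1 k.1, (F.equiv a).trans h.2 k.2⟩⟩
  V := fun p x => K.V p x.1.1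

namespace Form

variable {P : Type u} {A : Type v}

/-- Satisfaction of formulae without refinement quantifiers; these are the only ones it is used
for, and refinement quantifiers are ignored. -/
def Sat : Form P A → (K : Model P A) → K.W → Prop
  | atom p, K, s => K.V p s
  | neg φ, K, s => ¬ φ.Sat K s
  | and φ ψ, K, s => φ.Sat K s ∧ ψ.Sat K s
  | box a φ, K, s => ∀ s', K.R a s s' → φ.Sat K s'
  | act F pre T φ, K, s => ∀ t ∈ T, ∀ h : (pre t).Sat K s,
      φ.Sat (K.upd F fun t s => (pre t).Sat K s) ⟨(s, t), h⟩
  | allRef φ, K, s => φ.Sat K s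

/-- The formulae without refinement quantifiers. -/
def RefFree : Form P A → Prop
  | atom _ => True
  | neg φ => φ.RefFree
  | and φ ψ => φ.RefFree ∧ ψ.RefFree
  | box _ φ => φ.RefFree
  | act _ pre _ φ => (∀ t, (pre t).RefFree) ∧ φ.RefFree
  | allRef _ => False

theorem refFree_ofModal (m : ModalForm P A) : (ofModal m).RefFree := by
  induction m with
  | atom p => trivial
  | neg φ ih => exact ih
  | and φ ψ ih ih' => exact ⟨ih, ih'⟩
  | box a φ ih => exact ih

theorem sat_ofModal (m : ModalForm P A) (K : Model P A) (s : K.W) :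
    (ofModal m).Sat K s ↔ m.Sat K s := by
  induction m generalizing s with
  | atom p => rfl
  | neg φ ih => simp [ofModal, Sat, ModalForm.Sat, ih]
  | and φ ψ ih ih' => simp [ofModal, Sat, ModalForm.Sat, ih, ih']
  | box a φ ih => simp [ofModal, Sat, ModalForm.Sat, ih]

theorem ofModal_or (φ ψ : ModalForm P A) :
    ofModal (φ.or ψ) = or (ofModal φ) (ofModal ψ) := rfl

theorem ofModal_dia (a : A) (φ : ModalForm P A) :
    ofModal (φ.dia a) = dia a (ofModal φ) := rfl

theorem ofModal_bigAnd [Nonempty P] {ι : Type*} (s : Finset ι) (f : ι → ModalForm P A) :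
    ofModal (ModalForm.bigAnd s f) = bigAnd s fun i => ofModal (f i) := by
  simp only [ModalForm.bigAnd, bigAnd]
  induction s.toList with
  | nil => rfl
  | cons i l ih => simp [ofModal, ih]

theorem ofModal_bigOr [Nonempty P] {ι : Type*} (s : Finset ι) (f : ι → ModalForm P A) :
    ofModal (ModalForm.bigOr s f) = bigOr s fun i => ofModal (f i) := by
  simp only [ModalForm.bigOr, bigOr]
  induction s.toList with
  | nil => rfl
  | cons i l ih => simp [ofModal_or, ih]

theorem ofModal_cover [Nonempty P] (a : A) (Γ : Finset (ModalForm P A)) :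
    ofModal (ModalForm.cover a Γ) = cover a Γ := by
  simp [ModalForm.cover, cover, ofModal, ofModal_bigAnd, ofModal_bigOr, ofModal_dia]

/-- Assignments of truth values that respect negation and conjunction. -/
structure Respects (v : Form P A → Prop) : Prop where
  neg : ∀ φ, v (neg φ) ↔ ¬ v φ
  and : ∀ φ ψ, v (and φ ψ) ↔ (v φ ∧ v ψ)

namespace Respects

variable {v : Form P A → Prop}

theorem imp (h : Respects v) (φ ψ : Form P A) : v (imp φ ψ) ↔ (v φ → v ψ) := by
  simp [Form.imp, h.neg, h.and]

theorem or (h : Respects v) (φ ψ : Form P A) : v (or φ ψ) ↔ (v φ ∨ v ψ) := by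
  simp only [Form.or, h.neg, h.and]
  tauto

theorem iff (h : Respects v) (φ ψ : Form P A) : v (iff φ ψ) ↔ (v φ ↔ v ψ) := by
  simp only [Form.iff, h.imp, h.and]
  tauto

theorem top [Nonempty P] (h : Respects v) : v top := by
  simp only [Form.top, h.or, h.neg]
  tauto

theorem bigAnd [Nonempty P] (h : Respects v) {ι : Type*} (s : Finset ι) (f : ι → Form P A) :
    v (bigAnd s f) ↔ ∀ i ∈ s, v (f i) := by
  simp only [Form.bigAnd, ← Finset.mem_toList (s := s)]
  induction s.toList with
  | nil => simp [h.top]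
  | cons i l ih => simp [h.and, ih]

theorem bigOr [Nonempty P] (h : Respects v) {ι : Type*} (s : Finset ι) (f : ι → Form P A) :
    v (bigOr s f) ↔ ∃ i ∈ s, v (f i) := by
  simp only [Form.bigOr, ← Finset.mem_toList (s := s)]
  induction s.toList with
  | nil => simp [bot, h.neg, h.top]
  | cons i l ih => simp [h.or, ih]

end Respects

end Form

-- Derived rules of the calculus.

open Form

namespace Provable

variable {P : Type u} {A : Type v} [Nonempty P] [Fintype A]

theorem of_respects {φ : Form P A} (h : ∀ v, Respects v → v φ) : Provable φ :=
  .taut fun v hn ha => h v ⟨hn, ha⟩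

/-- Propositional consequence. -/
theorem conseq {φ ψ : Form P A} (h : Provable φ) (k : ∀ v, Respects v → v φ → v ψ) :
    Provable ψ :=
  .mp (.of_respects fun v hv => (hv.imp φ ψ).2 (k v hv)) h

theorem conj {φ ψ : Form P A} (h : Provable φ) (k : Provable ψ) : Provable (and φ ψ) :=
  .mp (h.conseq (ψ := imp ψ (and φ ψ)) fun v hv => by
    simp only [hv.imp, hv.and]
    tauto) k

theorem bigAnd {ι : Type*} {s : Finset ι} {f : ι → Form P A} (h : ∀ i ∈ s, Provable (f i)) :
    Provable (bigAnd s f) := by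
  simp only [Form.bigAnd, ← Finset.mem_toList (s := s)] at h ⊢
  generalize s.toList = l at h
  induction l with
  | nil => exact .of_respects fun v hv => hv.top
  | cons i l ih => exact (h i (by simp)).conj (ih fun j hj => h j (by simp [hj]))

theorem trans {φ ψ χ : Form P A} (h : Provable (imp φ ψ)) (k : Provable (imp ψ χ)) :
    Provable (imp φ χ) :=
  (h.conj k).conseq fun v hv => by
    simp only [hv.imp, hv.and]
    tauto

theorem iff_trans {φ ψ χ : Form P A} (h : Provable (iff φ ψ)) (k : Provable (iff ψ χ)) :
    Provable (iff φ χ) :=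
  (h.conj k).conseq fun v hv => by
    simp only [hv.iff, hv.and]
    tauto

theorem iff_intro {φ ψ : Form P A} (h : Provable (imp φ ψ)) (k : Provable (imp ψ φ)) :
    Provable (iff φ ψ) := h.conj k

theorem iff_mp {φ ψ : Form P A} (h : Provable (iff φ ψ)) : Provable (imp φ ψ) :=
  h.conseq fun _ hv => ((hv.and _ _).1 · |>.1)

theorem iff_mpr {φ ψ : Form P A} (h : Provable (iff φ ψ)) : Provable (imp ψ φ) :=
  h.conseq fun _ hv => ((hv.and _ _).1 · |>.2)

theorem bigAnd_iff {ι : Type*} {s : Finset ι} {f g : ι → Form P A}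
    (h : ∀ i ∈ s, Provable (iff (f i) (g i))) :
    Provable (iff (Form.bigAnd s f) (Form.bigAnd s g)) :=
  (bigAnd h).conseq fun v hv => by
    simp only [hv.iff, hv.bigAnd]
    exact fun k => forall₂_congr k

theorem box_imp (a : A) {φ ψ : Form P A} (h : Provable (imp φ ψ)) :
    Provable (imp (box a φ) (box a ψ)) :=
  .mp (.axK a φ ψ) (.nec a h)

theorem neg_imp {φ ψ : Form P A} (h : Provable (imp φ ψ)) : Provable (imp (neg ψ) (neg φ)) :=
  h.conseq fun v hv => by
    simp only [hv.imp, hv.neg]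
    tauto

theorem dia_imp (a : A) {φ ψ : Form P A} (h : Provable (imp φ ψ)) :
    Provable (imp (dia a φ) (dia a ψ)) :=
  (h.neg_imp.box_imp a).neg_imp

theorem allRef_imp {φ ψ : Form P A} (h : Provable (imp φ ψ)) :
    Provable (imp (allRef φ) (allRef ψ)) :=
  .mp (.axR φ ψ) (.necR h)

theorem someRef_imp {φ ψ : Form P A} (h : Provable (imp φ ψ)) :
    Provable (imp (someRef φ) (someRef ψ)) :=
  (h.neg_imp.allRef_imp).neg_imp

/-- Dually, `∀¬φ` and `∀¬ψ` give `∀¬(φ ∨ ψ)` by distribution of `∀` over implication. -/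
theorem someRef_or (φ ψ : Form P A) :
    Provable (imp (someRef (or φ ψ)) (or (someRef φ) (someRef ψ))) := by
  have h : Provable (imp (neg φ) (imp (neg ψ) (neg (or φ ψ)))) := .of_respects fun v hv => by
    simp only [hv.imp, hv.neg, hv.or]
    tauto
  refine (h.allRef_imp.conj (.axR (neg ψ) (neg (or φ ψ)))).conseq fun v hv => ?_
  simp only [someRef, hv.imp, hv.neg, hv.or, hv.and]
  tauto

theorem someRef_bigOr {ι : Type*} (s : Finset ι) (f : ι → Form P A) :
    Provable (imp (someRef (bigOr s f)) (bigOr s fun i => someRef (f i))) := by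
  simp only [Form.bigOr]
  induction s.toList with
  | nil =>
    have h : Provable (neg (bot : Form P A)) := .of_respects fun v hv => by
      simp [bot, hv.neg, hv.top]
    refine h.necR.conseq fun v hv => ?_
    simp only [someRef, hv.imp, hv.neg, List.map_nil, List.foldr_nil]
    exact fun h k => absurd h k
  | cons i l ih =>
    refine (ih.conj (someRef_or (f i) ((l.map f).foldr or bot))).conseq fun v hv => ?_
    simp only [hv.imp, hv.and, hv.or, List.map_cons, List.foldr_cons]
    tauto

theorem ofModal {m : ModalForm P A} (h : m.ProvesS5) : Provable (ofModal m) := by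
  induction h with
  | taut h =>
    exact .of_respects fun v hv => h (fun φ => v (Form.ofModal φ)) (fun _ => hv.neg _)
      (fun _ _ => hv.and _ _)
  | axK a φ ψ => exact .axK a _ _
  | axT a φ => exact .axT a _
  | ax4 a φ => exact .ax4 a _
  | ax5 a φ => exact .ax5 a _
  | mp _ _ h k => exact .mp h k
  | nec a _ h => exact .nec a h

end Provable

theorem ActModel.mem_ptsFinset {P : Type u} {A : Type v} {M : ActModel P A} {t : M.frame.pt} :
    t ∈ M.ptsFinset ↔ t ∈ M.pts := by
  simp [ActModel.ptsFinset]

namespace Provable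

variable {P : Type u} {A : Type v} [Nonempty P] [Fintype A]

/-- An action that cannot be executed makes every box true. The calculus has no K axiom for action
models, and this fact is what is missing in order to derive monotonicity. Every reduction axiom but
the one for conjunction has the precondition as a guard; nested actions are handled by composition.
-/
theorem allAct_of_neg_pre {φ : Form P A} (hφ : φ.RefFree) (M : ActModel P A) (t : M.frame.pt) :
    Provable (imp (neg (M.pre t)) (allAct (M.withPts {t}) φ)) := by
  induction φ generalizing M with
  | atom p =>
    refine (axAP M t p).conseq fun v hv => ?_
    simp only [hv.iff, hv.imp, hv.neg]
    tauto
  | neg φ _ =>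
    refine (axAN M t φ).conseq fun v hv => ?_
    simp only [hv.iff, hv.imp, hv.neg]
    tauto
  | and φ ψ ih ih' =>
    refine ((axAC M t φ ψ).conj ((ih hφ.1 M t).conj (ih' hφ.2 M t))).conseq fun v hv => ?_
    simp only [hv.iff, hv.imp, hv.neg, hv.and]
    tauto
  | box a φ _ =>
    refine (axAK M t a φ).conseq fun v hv => ?_
    simp only [hv.iff, hv.imp, hv.neg]
    tauto
  | act F pre T φ _ ih =>
    let N : ActModel P A := ⟨F, pre, T⟩
    let S := (M.withPts {t}).seq N
    -- The precondition of the composite at `(t, y)` is `⟨M_t⟩pre(y)`, refuted by `axAN` when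
    -- `pre(t)` fails. The equation `t = t'` is kept as a hypothesis because the designated points
    -- of `S` have first coordinate `t` only propositionally.
    have key : ∀ (t' : M.frame.pt) (y : F.pt), t = t' →
        Provable (imp (neg (M.pre t)) (allAct (S.withPts {(t', y)}) φ)) := by
      rintro _ y rfl
      have e : S.pre (t, y) = neg (allAct (M.withPts {t}) (neg (N.pre y))) := rfl
      have k := ih hφ.2 S (t, y)
      rw [e] at k
      refine (k.conj (axAN M t (N.pre y))).conseq fun v hv => ?_
      simp only [hv.iff, hv.imp, hv.neg, hv.and]
      tauto
    have h : ∀ x ∈ S.ptsFinset, Provable (imp (neg (M.pre t)) (allAct (S.withPts {x}) φ)) :=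
      fun x hx => key x.1 x.2 (ActModel.mem_ptsFinset.1 hx).1.symm
    refine ((bigAnd h).conj ((axAS (M.withPts {t}) N φ).conj (axAU S φ))).conseq fun v hv => ?_
    simp only [hv.iff, hv.imp, hv.neg, hv.and, hv.bigAnd]
    rintro ⟨h1, h2, h3⟩ h4
    exact h2.1 (h3.2 fun i hi => h1 i hi h4)
  | allRef φ _ => exact hφ.elim

/-- Where the precondition holds, `axAN` and `axAC` unfold the necessitated implication into an
implication of boxes; where it fails, the conclusion holds by `allAct_of_neg_pre`. -/
theorem allAct_pt_imp {φ ψ : Form P A} (hψ : ψ.RefFree) (h : Provable (imp φ ψ))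
    (M : ActModel P A) (t : M.frame.pt) :
    Provable (imp (allAct (M.withPts {t}) φ) (allAct (M.withPts {t}) ψ)) := by
  refine ((allAct_of_neg_pre hψ M t).conj ((h.necA (M.withPts {t})).conj
    ((axAN M t (and φ (neg ψ))).conj ((axAC M t φ (neg ψ)).conj (axAN M t ψ))))).conseq
    fun v hv => ?_
  rw [imp]
  simp only [hv.iff, hv.imp, hv.neg, hv.and]
  tauto

theorem allAct_imp {φ ψ : Form P A} (hψ : ψ.RefFree) (h : Provable (imp φ ψ))
    (M : ActModel P A) : Provable (imp (allAct M φ) (allAct M ψ)) := by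
  have k := bigAnd (s := M.ptsFinset) fun t _ => allAct_pt_imp hψ h M t
  refine (k.conj ((axAU M φ).conj (axAU M ψ))).conseq fun v hv => ?_
  simp only [hv.iff, hv.imp, hv.and, hv.bigAnd]
  rintro ⟨h1, h2, h3⟩ h4
  exact h3.2 fun t ht => h1 t ht (h2.1 h4 t ht)

end Provable

/-- The result of executing an action model on a Kripke model. -/
def ActModel.exec {P : Type u} {A : Type v} (M : ActModel P A) (K : Model P A) : Model P A :=
  K.upd M.frame fun t s => (M.pre t).Sat K s

namespace Form

variable {P : Type u} {A : Type v}

theorem sat_allAct {M : ActModel P A} {φ : Form P A} {K : Model P A} {s : K.W} :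
    (allAct M φ).Sat K s ↔
      ∀ t ∈ M.pts, ∀ h : (M.pre t).Sat K s, φ.Sat (M.exec K) ⟨(s, t), h⟩ := Iff.rfl

theorem sat_someAct {M : ActModel P A} {φ : Form P A} {K : Model P A} {s : K.W} :
    (someAct M φ).Sat K s ↔
      ∃ t ∈ M.pts, ∃ h : (M.pre t).Sat K s, φ.Sat (M.exec K) ⟨(s, t), h⟩ := by
  simp [someAct, Sat, sat_allAct]

theorem sat_allAct_pt {M : ActModel P A} {t : M.frame.pt} {φ : Form P A} {K : Model P A}
    {s : K.W} : (allAct (M.withPts {t}) φ).Sat K s ↔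
      ∀ h : (M.pre t).Sat K s, φ.Sat (M.exec K) ⟨(s, t), h⟩ := by
  refine ⟨fun h k => h t rfl k, ?_⟩
  intro h t' ht
  have key : ∀ t' : M.frame.pt, t = t' → ∀ h : (M.pre t').Sat K s,
      φ.Sat (M.exec K) ⟨(s, t'), h⟩ := by
    rintro _ rfl
    exact h
  exact key t' (Eq.symm ht)

theorem sat_imp {φ ψ : Form P A} {K : Model P A} {s : K.W} :
    (imp φ ψ).Sat K s ↔ (φ.Sat K s → ψ.Sat K s) := by
  simp [imp, Sat]

theorem sat_someAct_pt {M : ActModel P A} {t : M.frame.pt} {φ : Form P A} {K : Model P A}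
    {s : K.W} : (someAct (M.withPts {t}) φ).Sat K s ↔
      ∃ h : (M.pre t).Sat K s, φ.Sat (M.exec K) ⟨(s, t), h⟩ := by
  rw [someAct, Sat, sat_allAct_pt]
  simp [Sat]

variable [Nonempty P] [Fintype A]

/-- `m` is provably and semantically equivalent to `φ`. -/
def Reduces (φ : Form P A) (m : ModalForm P A) : Prop :=
  Provable (iff φ (ofModal m)) ∧ ∀ K s, φ.Sat K s ↔ m.Sat K s

theorem Reduces.of_iff {φ ψ : Form P A} {m : ModalForm P A} (h : ψ.Reduces m)
    (k : Provable (iff φ ψ)) (l : ∀ K s, φ.Sat K s ↔ ψ.Sat K s) : φ.Reduces m :=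
  ⟨k.iff_trans h.1, fun K s => (l K s).trans (h.2 K s)⟩

theorem Reduces.neg {φ : Form P A} {m : ModalForm P A} (h : φ.Reduces m) :
    (neg φ).Reduces m.neg := by
  refine ⟨h.1.conseq fun v hv => ?_, fun K s => not_congr (h.2 K s)⟩
  simp only [ofModal, hv.iff, hv.neg]
  tauto

theorem Reduces.and {φ ψ : Form P A} {m n : ModalForm P A} (h : φ.Reduces m)
    (k : ψ.Reduces n) : (and φ ψ).Reduces (m.and n) := by
  refine ⟨(h.1.conj k.1).conseq fun v hv => ?_, fun K s => and_congr (h.2 K s) (k.2 K s)⟩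
  simp only [ofModal, hv.iff, hv.and]
  tauto

theorem Reduces.imp {φ ψ : Form P A} {m n : ModalForm P A} (h : φ.Reduces m)
    (k : ψ.Reduces n) : (imp φ ψ).Reduces (m.imp n) := (h.and k.neg).neg

theorem Reduces.box (a : A) {φ : Form P A} {m : ModalForm P A} (h : φ.Reduces m) :
    (box a φ).Reduces (m.box a) :=
  ⟨.iff_intro (h.1.iff_mp.box_imp a) (h.1.iff_mpr.box_imp a),
    fun K _ => forall₂_congr fun s _ => h.2 K s⟩

theorem Reduces.allAct_of_pts {M : ActModel P A} {φ : Form P A}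
    (h : ∀ t ∈ M.pts, ∃ m, (allAct (M.withPts {t}) φ).Reduces m) :
    ∃ m, (allAct M φ).Reduces m := by
  have : Nonempty (ModalForm P A) := ⟨.top⟩
  choose! f hf using h
  refine ⟨.bigAnd M.ptsFinset f, ?_, fun K s => ?_⟩
  · rw [ofModal_bigAnd]
    exact (Provable.axAU M φ).iff_trans
      (.bigAnd_iff fun t ht => (hf t (ActModel.mem_ptsFinset.1 ht)).1)
  · simp only [ModalForm.sat_bigAnd, ActModel.mem_ptsFinset]
    exact forall₂_congr fun t ht => sat_allAct_pt.symm.trans ((hf t ht).2 K s)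

/-- The reduction axioms push the action inwards through a modal formula. The point must vary in the
induction, since the case of a box passes to all points related to it. -/
theorem exists_reduces_allAct_pt {M : ActModel P A} (hM : ∀ t, ∃ m, (M.pre t).Reduces m)
    (n : ModalForm P A) (t : M.frame.pt) :
    ∃ m, (allAct (M.withPts {t}) (ofModal n)).Reduces m := by
  obtain ⟨l, hl⟩ := hM t
  induction n generalizing t l with
  | atom p =>
    refine ⟨l.imp (.atom p), (hl.imp (ψ := atom p) ⟨?_, fun _ _ => Iff.rfl⟩).of_iff
      (.axAP M t p) fun K s => ?_⟩
    · exact .of_respects fun v hv => (hv.iff _ _).2 Iff.rfl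
    · rw [sat_allAct_pt, sat_imp]
      rfl
  | neg φ ih =>
    obtain ⟨m, hm⟩ := ih t l hl
    refine ⟨_, (hl.imp hm.neg).of_iff (.axAN M t _) fun K s => ?_⟩
    rw [sat_allAct_pt, sat_imp]
    refine forall_congr' fun h => ?_
    simp only [Sat]
    rw [sat_allAct_pt]
    exact ⟨fun k k' => k (k' h), fun k k' => k fun _ => k'⟩
  | and φ ψ ih ih' =>
    obtain ⟨m, hm⟩ := ih t l hl
    obtain ⟨m', hm'⟩ := ih' t l hl
    refine ⟨_, (hm.and hm').of_iff (.axAC M t _ _) fun K s => ?_⟩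
    simp only [ofModal, Sat, sat_allAct_pt, forall_and]
  | box a φ ih =>
    obtain ⟨m, hm⟩ := Reduces.allAct_of_pts (M := M.withPts {u | M.frame.rel a t u})
      (φ := ofModal φ) fun u _ => (hM u).elim fun l hl => ih u l hl
    refine ⟨_, (hl.imp (hm.box a)).of_iff (.axAK M t a _) fun K s => ?_⟩
    rw [sat_allAct_pt, sat_imp]
    refine forall_congr' fun h => ⟨?_, ?_⟩
    · exact fun k s' r u r' h' => k ⟨(s', u), h'⟩ ⟨r, r'⟩
    · exact fun k x r => k x.1.1 r.1 x.1.2 r.2 x.2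

/-- Innermost actions go first: the body becomes modal, monotonicity replaces it under the action,
and the action is then pushed through a purely modal formula. -/
theorem exists_reduces {φ : Form P A} (hφ : φ.RefFree) : ∃ m, φ.Reduces m := by
  induction φ with
  | atom p => exact ⟨.atom p, .of_respects fun v hv => (hv.iff _ _).2 Iff.rfl, fun _ _ => Iff.rfl⟩
  | neg φ ih => exact (ih hφ).imp' _ fun _ => Reduces.neg
  | and φ ψ ih ih' =>
    obtain ⟨m, hm⟩ := ih hφ.1
    obtain ⟨n, hn⟩ := ih' hφ.2
    exact ⟨_, hm.and hn⟩
  | box a φ ih => exact (ih hφ).imp' _ fun _ => Reduces.box a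
  | act F pre T φ ih ih' =>
    let M : ActModel P A := ⟨F, pre, T⟩
    obtain ⟨n, hn⟩ := ih' hφ.2
    obtain ⟨m, hm⟩ := Reduces.allAct_of_pts (M := M) (φ := ofModal n) fun t _ =>
      exists_reduces_allAct_pt (M := M) (fun t => ih t (hφ.1 t)) n t
    refine ⟨m, hm.of_iff (φ := allAct M φ) (.iff_intro
      (.allAct_imp (refFree_ofModal n) hn.1.iff_mp M) (.allAct_imp hφ.2 hn.1.iff_mpr M))
      fun K s => ?_⟩
    simp only [sat_allAct]
    exact forall₃_congr fun t _ _ => (hn.2 _ _).trans (sat_ofModal _ _ _).symm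
  | allRef φ _ => exact hφ.elim

end Form

/-- Completeness of the refinement-free fragment. It lets the rest of the argument work with Kripke
models and types. -/
theorem Provable.of_valid {P : Type u} {A : Type v} [Nonempty P] [Fintype A] {φ : Form P A}
    (hφ : φ.RefFree) (h : ∀ K s, φ.Sat K s) : Provable φ := by
  obtain ⟨m, hm⟩ := exists_reduces hφ
  exact .mp hm.1.iff_mpr (.ofModal (.complete fun K s => (hm.2 K s).1 (h K s)))

/-! ## Types of bounded modal depth and their characteristic formulae -/

/-- The types of modal depth at most `k` over the atoms in `Q`. -/
def Ty {P : Type u} (Q : Finset P) (A : Type v) : ℕ → Type (max u v)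
  | 0 => ULift.{v} (Set Q)
  | k + 1 => Ty Q A k × (A → Set (Ty Q A k))

instance {P : Type u} {Q : Finset P} {A : Type v} [Finite A] (k : ℕ) : Finite (Ty Q A k) := by
  induction k with
  | zero => exact inferInstanceAs (Finite (ULift.{v} (Set Q)))
  | succ k ih => exact inferInstanceAs (Finite (Ty Q A k × (A → Set (Ty Q A k))))

/-- The type of a world. -/
def Model.ty {P : Type u} {A : Type v} (Q : Finset P) (K : Model P A) :
    (k : ℕ) → K.W → Ty Q A k
  | 0, s => ⟨{q | K.V q s}⟩
  | k + 1, s => (K.ty Q k s, fun a => {σ | ∃ s', K.R a s s' ∧ K.ty Q k s' = σ})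

namespace Model

variable {P : Type u} {A : Type v} {Q : Finset P} {K K' : Model P A}

theorem mem_ty_succ {k : ℕ} {s : K.W} {a : A} {σ : Ty Q A k} :
    σ ∈ (K.ty Q (k + 1) s).2 a ↔ ∃ s', K.R a s s' ∧ K.ty Q k s' = σ := Iff.rfl

theorem ty_eq_of_le {k l : ℕ} (h : k ≤ l) {s : K.W} {s' : K'.W}
    (e : K.ty Q l s = K'.ty Q l s') : K.ty Q k s = K'.ty Q k s' := by
  induction h with
  | refl => exact e
  | step _ ih => exact ih (congrArg Prod.fst e)

/-- Indistinguishable worlds have the same class. This is the coherence of S5 types on which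
learning relies. -/
theorem ty_succ_snd_eq (k : ℕ) {a : A} {s s' : K.W} (h : K.R a s s') :
    (K.ty Q (k + 1) s).2 a = (K.ty Q (k + 1) s').2 a := by
  ext σ
  simp only [mem_ty_succ]
  exact ⟨fun ⟨t, r, e⟩ => ⟨t, (K.equiv a).trans ((K.equiv a).symm h) r, e⟩,
    fun ⟨t, r, e⟩ => ⟨t, (K.equiv a).trans h r, e⟩⟩

end Model

-- Modal depth and invariance under equality of types.

namespace ModalForm

variable {P : Type u} {A : Type v}

/-- Formulae of modal depth at most `k` over the atoms in `Q`. -/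
def Bdd (Q : Finset P) : ModalForm P A → ℕ → Prop
  | atom p, _ => p ∈ Q
  | neg φ, k => φ.Bdd Q k
  | and φ ψ, k => φ.Bdd Q k ∧ ψ.Bdd Q k
  | box _ _, 0 => False
  | box _ φ, k + 1 => φ.Bdd Q k

variable {Q : Finset P}

theorem Bdd.succ {φ : ModalForm P A} {k : ℕ} (h : φ.Bdd Q k) : φ.Bdd Q (k + 1) := by
  induction φ generalizing k with
  | atom p => exact h
  | neg φ ih => exact ih h
  | and φ ψ ih ih' => exact ⟨ih h.1, ih' h.2⟩
  | box a φ ih =>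
    cases k with
    | zero => exact h.elim
    | succ k => exact ih (k := k) h

theorem Bdd.mono {φ : ModalForm P A} {k l : ℕ} (h : φ.Bdd Q k) (hl : k ≤ l) : φ.Bdd Q l := by
  induction hl with
  | refl => exact h
  | step _ ih => exact ih.succ

theorem Bdd.mono_atoms {φ : ModalForm P A} {k : ℕ} (h : φ.Bdd Q k) {Q' : Finset P}
    (hQ : Q ⊆ Q') : φ.Bdd Q' k := by
  induction φ generalizing k with
  | atom p => exact hQ h
  | neg φ ih => exact ih h
  | and φ ψ ih ih' => exact ⟨ih h.1, ih' h.2⟩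
  | box a φ ih =>
    cases k with
    | zero => exact h.elim
    | succ k => exact ih (k := k) h

theorem exists_bdd (φ : ModalForm P A) (Q₀ : Finset P) :
    ∃ (Q : Finset P) (k : ℕ), Q₀ ⊆ Q ∧ φ.Bdd Q k := by
  classical
  induction φ with
  | atom p => exact ⟨insert p Q₀, 0, Finset.subset_insert _ _, Finset.mem_insert_self _ _⟩
  | neg φ ih => exact ih
  | and φ ψ ih ih' =>
    obtain ⟨Q, k, hQ, h⟩ := ih
    obtain ⟨Q', k', _, h'⟩ := ih'
    exact ⟨Q ∪ Q', max k k', hQ.trans Finset.subset_union_left,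
      (h.mono (le_max_left _ _)).mono_atoms Finset.subset_union_left,
      (h'.mono (le_max_right _ _)).mono_atoms Finset.subset_union_right⟩
  | box a φ ih =>
    obtain ⟨Q, k, hQ, h⟩ := ih
    exact ⟨Q, k + 1, hQ, h⟩

theorem Bdd.of_mem_subs {φ ψ : ModalForm P A} {k : ℕ} (h : φ.Bdd Q k) (hψ : ψ ∈ φ.subs) :
    ψ.Bdd Q k := by
  induction φ generalizing k with
  | atom p =>
    obtain rfl := hψ
    exact h
  | neg φ ih =>
    obtain rfl | hψ := hψ
    · exact h
    · exact ih h hψ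
  | and φ χ ih ih' =>
    obtain rfl | hψ | hψ := hψ
    · exact h
    · exact ih h.1 hψ
    · exact ih' h.2 hψ
  | box a φ ih =>
    obtain rfl | hψ := hψ
    · exact h
    · cases k with
      | zero => exact h.elim
      | succ k => exact (ih (k := k) h hψ).succ

theorem Bdd.sat_iff {φ : ModalForm P A} {k : ℕ} (h : φ.Bdd Q k) {K K' : Model P A} {s : K.W}
    {s' : K'.W} (e : K.ty Q k s = K'.ty Q k s') : φ.Sat K s ↔ φ.Sat K' s' := by
  induction φ generalizing k s s' with
  | atom p =>
    have e₀ := Model.ty_eq_of_le (Nat.zero_le k) e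
    have := congrArg (fun τ : Ty Q A 0 => (⟨p, h⟩ : Q) ∈ τ.down) e₀
    exact iff_of_eq this
  | neg φ ih => exact not_congr (ih h e)
  | and φ ψ ih ih' => exact and_congr (ih h.1 e) (ih' h.2 e)
  | box a φ ih =>
    cases k with
    | zero => exact h.elim
    | succ k =>
      have e' : (K.ty Q (k + 1) s).2 a = (K'.ty Q (k + 1) s').2 a := by rw [e]
      constructor
      · intro hs t r
        obtain ⟨t', r', et⟩ := Model.mem_ty_succ.1 (e' ▸ Model.mem_ty_succ.2 ⟨t, r, rfl⟩)
        exact (ih (k := k) h et).1 (hs t' r')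
      · intro hs t r
        obtain ⟨t', r', et⟩ := Model.mem_ty_succ.1 (e' ▸ Model.mem_ty_succ.2 ⟨t, r, rfl⟩)
        exact (ih (k := k) h et.symm).2 (hs t' r')

section

variable [Nonempty P]

theorem bdd_top (hQ : Classical.arbitrary P ∈ Q) (k : ℕ) : (top : ModalForm P A).Bdd Q k :=
  ⟨hQ, hQ⟩

theorem bdd_bigAnd (hQ : Classical.arbitrary P ∈ Q) {ι : Type*} {s : Finset ι}
    {f : ι → ModalForm P A} {k : ℕ} (h : ∀ i ∈ s, (f i).Bdd Q k) : (bigAnd s f).Bdd Q k := by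
  simp only [bigAnd, ← Finset.mem_toList (s := s)] at h ⊢
  generalize s.toList = l at h
  induction l with
  | nil => exact bdd_top hQ k
  | cons i l ih => exact ⟨h i (by simp), ih fun j hj => h j (by simp [hj])⟩

theorem bdd_bigOr (hQ : Classical.arbitrary P ∈ Q) {ι : Type*} {s : Finset ι}
    {f : ι → ModalForm P A} {k : ℕ} (h : ∀ i ∈ s, (f i).Bdd Q k) : (bigOr s f).Bdd Q k := by
  simp only [bigOr, ← Finset.mem_toList (s := s)] at h ⊢
  generalize s.toList = l at h
  induction l with
  | nil => exact bdd_top hQ k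
  | cons i l ih => exact ⟨h i (by simp), ih fun j hj => h j (by simp [hj])⟩

theorem bdd_cover (hQ : Classical.arbitrary P ∈ Q) {a : A} {Γ : Finset (ModalForm P A)} {k : ℕ}
    (h : ∀ γ ∈ Γ, γ.Bdd Q k) : (cover a Γ).Bdd Q (k + 1) :=
  ⟨bdd_bigOr (k := k) hQ h, bdd_bigAnd hQ fun γ hγ => h γ hγ⟩

end

/-- The formulae to be decided become fewer when agents are dropped, so the condition for all agents
also licenses the single-agent axiom `axRS5`. -/
theorem Explicit.mono {B B' : Set A} {γ₀ : ModalForm P A} {Γ : A → Finset (ModalForm P A)}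
    (h : Explicit B γ₀ Γ) (hB : B' ⊆ B) : Explicit B' γ₀ Γ := by
  obtain ⟨h₀, h₁, h₂⟩ := h
  refine ⟨fun a ha => h₀ a (hB ha), ?_, ?_⟩
  · rintro a ha γ hγ ψ ⟨b, hb, δ, hδ, hψ⟩
    exact h₁ a (hB ha) γ hγ ψ ⟨b, hB hb, δ, hδ, hψ⟩
  · rintro a ha γ hγ ψ ⟨b, hb, δ, hδ, hψ⟩
    exact h₂ a (hB ha) γ hγ ψ ⟨b, hB hb, δ, hδ, hψ⟩

end ModalForm

namespace Ty

open ModalForm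

variable {P : Type u} {A : Type v} [Nonempty P] [Fintype A] {Q : Finset P}

open Classical in
/-- The characteristic formula of a type. -/
noncomputable def chr : (k : ℕ) → Ty Q A k → ModalForm P A
  | 0, τ => bigAnd Finset.univ fun q : Q =>
      if q ∈ τ.down then atom q.1 else neg (atom q.1)
  | k + 1, τ => and (chr k τ.1)
      (bigAnd Finset.univ fun a => cover a ((Set.toFinite (τ.2 a)).toFinset.image (chr k)))

open Classical in
/-- The characteristic formulae of a set of types. -/
noncomputable def chrs {k : ℕ} (S : Set (Ty Q A k)) : Finset (ModalForm P A) :=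
  (Set.toFinite S).toFinset.image (chr k)

theorem mem_chrs {k : ℕ} {S : Set (Ty Q A k)} {γ : ModalForm P A} :
    γ ∈ chrs S ↔ ∃ σ ∈ S, chr k σ = γ := by
  simp [chrs]

theorem chr_succ (k : ℕ) (τ : Ty Q A (k + 1)) :
    chr (k + 1) τ = and (chr k τ.1) (bigAnd Finset.univ fun a => cover a (chrs (τ.2 a))) := rfl

/-- The two halves of the cover operator match the two inclusions between the set of successor types
and the prescribed set. -/
theorem sat_chr {k : ℕ} {τ : Ty Q A k} {K : Model P A} {s : K.W} :
    (chr k τ).Sat K s ↔ K.ty Q k s = τ := by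
  induction k generalizing s with
  | zero =>
    simp only [chr, sat_bigAnd, Finset.mem_univ, forall_const]
    constructor
    · intro h
      refine congrArg ULift.up (Set.ext fun q => ?_)
      have := h q
      split_ifs at this with hq
      · exact iff_of_true this hq
      · exact iff_of_false this hq
    · rintro rfl q
      split_ifs with hq
      · exact hq
      · exact hq
  | succ k ih =>
    simp only [chr_succ, ModalForm.Sat, sat_bigAnd, Finset.mem_univ, forall_const, sat_cover, ih]
    constructor
    · rintro ⟨h, h'⟩
      refine Prod.ext h (funext fun a => Set.ext fun σ => ?_)
      rw [Model.mem_ty_succ]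
      constructor
      · rintro ⟨t, r, rfl⟩
        obtain ⟨γ, hγ, ht⟩ := (h' a).1 t r
        obtain ⟨σ, hσ, rfl⟩ := mem_chrs.1 hγ
        rw [ih.1 ht]
        exact hσ
      · intro hσ
        obtain ⟨t, r, ht⟩ := (h' a).2 _ (mem_chrs.2 ⟨σ, hσ, rfl⟩)
        exact ⟨t, r, ih.1 ht⟩
    · rintro rfl
      refine ⟨rfl, fun a => ⟨fun t r => ⟨_, mem_chrs.2 ⟨_, ⟨t, r, rfl⟩, rfl⟩, ih.2 rfl⟩, ?_⟩⟩
      intro γ hγ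
      obtain ⟨_, ⟨t, r, rfl⟩, rfl⟩ := mem_chrs.1 hγ
      exact ⟨t, r, ih.2 rfl⟩

theorem bdd_chr (hQ : Classical.arbitrary P ∈ Q) {k : ℕ} (τ : Ty Q A k) :
    (chr k τ).Bdd Q k := by
  induction k with
  | zero =>
    refine bdd_bigAnd hQ fun q _ => ?_
    split_ifs
    · exact q.2
    · exact q.2
  | succ k ih =>
    refine ⟨(ih _).succ, bdd_bigAnd hQ fun a _ => bdd_cover hQ fun γ hγ => ?_⟩
    obtain ⟨σ, _, rfl⟩ := mem_chrs.1 hγ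
    exact ih σ

theorem isProp_chr_zero (τ : Ty Q A 0) : (Form.ofModal (chr 0 τ)).IsProp := by
  rw [chr, Form.ofModal_bigAnd, Form.bigAnd]
  induction (Finset.univ : Finset Q).toList with
  | nil => exact ⟨trivial, trivial⟩
  | cons q l ih =>
    refine ⟨?_, ih⟩
    beta_reduce
    split_ifs
    · trivial
    · trivial

/-- All worlds that satisfy the characteristic formula share a type and hence agree on `ψ`, so by
completeness provability amounts to truth at one world. -/
theorem provesS5_chr_imp {k : ℕ} {K : Model P A} {s : K.W} {ψ : ModalForm P A}
    (hψ : ψ.Bdd Q k) : ProvesS5 ((chr k (K.ty Q k s)).imp ψ) ↔ ψ.Sat K s := by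
  rw [provesS5_iff]
  refine ⟨fun h => sat_imp.1 (h K s) (sat_chr.2 rfl), fun h K' s' => sat_imp.2 fun h' => ?_⟩
  exact (hψ.sat_iff (sat_chr.1 h')).2 h

/-- All formulae concerned have depth at most `k` and are decided by depth-`k` types. As the type is
realised, condition (ii) becomes the truth condition of a box in the class of `s`. -/
theorem explicit_chr (hQ : Classical.arbitrary P ∈ Q) {k : ℕ} {K : Model P A} (s : K.W) :
    Explicit Set.univ (chr k (K.ty Q k s)) fun a => chrs ((K.ty Q (k + 1) s).2 a) := by
  have hΨ : ∀ ψ : ModalForm P A, (∃ a ∈ Set.univ, ∃ γ ∈ chrs ((K.ty Q (k + 1) s).2 a),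
      ψ ∈ γ.subs) → ψ.Bdd Q k := by
    rintro ψ ⟨a, _, γ, hγ, hψ⟩
    obtain ⟨σ, _, rfl⟩ := mem_chrs.1 hγ
    exact (bdd_chr hQ σ).of_mem_subs hψ
  refine ⟨fun a _ => mem_chrs.2 ⟨_, ⟨s, (K.equiv a).refl s, rfl⟩, rfl⟩, ?_, ?_⟩
  · intro a _ γ hγ ψ hψ
    obtain ⟨_, ⟨t, r, rfl⟩, rfl⟩ := mem_chrs.1 hγ
    rw [provesS5_chr_imp (hΨ ψ hψ), provesS5_chr_imp (ψ := neg ψ) (hΨ ψ hψ)]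
    exact em _
  · intro a _ γ hγ ψ hψ
    obtain ⟨_, ⟨t, r, rfl⟩, rfl⟩ := mem_chrs.1 hγ
    have hb := hΨ _ hψ
    rw [provesS5_chr_imp hb]
    have hb' : ψ.Bdd Q k := by
      cases k with
      | zero => exact hb.elim
      | succ k => exact Bdd.succ (k := k) hb
    constructor
    · intro h γ' hγ'
      obtain ⟨_, ⟨t', r', rfl⟩, rfl⟩ := mem_chrs.1 hγ'
      rw [provesS5_chr_imp hb']
      exact h t' ((K.equiv a).trans ((K.equiv a).symm r) r')
    · intro h t' r'
      rw [← provesS5_chr_imp hb']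
      exact h _ (mem_chrs.2 ⟨_, ⟨t', (K.equiv a).trans r r', rfl⟩, rfl⟩)

end Ty

/-! ## The types that result from executing action models -/

/-- Bounded morphisms of Kripke models. -/
structure IsBoundedMorphism {P : Type u} {A : Type v} (K K' : Model P A) (f : K.W → K'.W) :
    Prop where
  val : ∀ p s, K.V p s ↔ K'.V p (f s)
  forth : ∀ a s t, K.R a s t → K'.R a (f s) (f t)
  back : ∀ a s t', K'.R a (f s) t' → ∃ t, K.R a s t ∧ f t = t'

namespace IsBoundedMorphism

variable {P : Type u} {A : Type v} {K K' : Model P A} {f : K.W → K'.W}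

theorem sat_iff (h : IsBoundedMorphism K K' f) (φ : ModalForm P A) (s : K.W) :
    φ.Sat K s ↔ φ.Sat K' (f s) := by
  induction φ generalizing s with
  | atom p => exact h.val p s
  | neg φ ih => exact not_congr (ih s)
  | and φ ψ ih ih' => exact and_congr (ih s) (ih' s)
  | box a φ ih =>
    constructor
    · intro k t' r
      obtain ⟨t, r', rfl⟩ := h.back a s t' r
      exact (ih t).1 (k t r')
    · exact fun k t r => (ih t).2 (k _ (h.forth a s t r))

theorem ty_eq (h : IsBoundedMorphism K K' f) (Q : Finset P) (k : ℕ) (s : K.W) :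
    K.ty Q k s = K'.ty Q k (f s) := by
  induction k generalizing s with
  | zero => exact congrArg ULift.up (Set.ext fun q => h.val q s)
  | succ k ih =>
    refine Prod.ext (ih s) (funext fun a => Set.ext fun σ => ?_)
    simp only [Model.mem_ty_succ]
    constructor
    · rintro ⟨t, r, rfl⟩
      exact ⟨f t, h.forth a s t r, (ih t).symm⟩
    · rintro ⟨t', r, rfl⟩
      obtain ⟨t, r', rfl⟩ := h.back a s t' r
      exact ⟨t, r', ih t⟩

end IsBoundedMorphism

namespace ActModel

variable {P : Type u} {A : Type v}

/-- The types of the results of executing `M` at `s`. -/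
def post (Q : Finset P) (M : ActModel P A) (K : Model P A) (s : K.W) (k : ℕ) :
    Set (Ty Q A k) :=
  {σ | ∃ t ∈ M.pts, ∃ h : (M.pre t).Sat K s, (M.exec K).ty Q k ⟨(s, t), h⟩ = σ}

variable {Q : Finset P}

theorem post_nonempty_iff {M : ActModel P A} {K : Model P A} {s : K.W} {k : ℕ} :
    (M.post Q K s k).Nonempty ↔ ∃ t ∈ M.pts, (M.pre t).Sat K s :=
  ⟨fun ⟨_, t, ht, h, _⟩ => ⟨t, ht, h⟩, fun ⟨t, ht, h⟩ => ⟨_, t, ht, h, rfl⟩⟩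

theorem mem_post_succ_fst {M : ActModel P A} {K : Model P A} {s : K.W} {k : ℕ}
    {τ : Ty Q A (k + 1)} (h : τ ∈ M.post Q K s (k + 1)) : τ.1 ∈ M.post Q K s k := by
  obtain ⟨t, ht, h, rfl⟩ := h
  exact ⟨t, ht, h, rfl⟩

theorem isBoundedMorphism_inl (M N : ActModel P A) (K : Model P A) :
    IsBoundedMorphism (M.exec K) ((M.choice N).exec K)
      fun x => ⟨(x.1.1, Sum.inl x.1.2), x.2⟩ where
  val _ _ := Iff.rfl
  forth _ _ _ r := ⟨r.1, .inl r.2⟩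
  back := by
    rintro a x ⟨⟨s', u⟩, h⟩ ⟨r, r'⟩
    cases r' with
    | inl r' => exact ⟨⟨(s', _), h⟩, ⟨r, r'⟩, rfl⟩

theorem isBoundedMorphism_inr (M N : ActModel P A) (K : Model P A) :
    IsBoundedMorphism (N.exec K) ((M.choice N).exec K)
      fun x => ⟨(x.1.1, Sum.inr x.1.2), x.2⟩ where
  val _ _ := Iff.rfl
  forth _ _ _ r := ⟨r.1, .inr r.2⟩
  back := by
    rintro a x ⟨⟨s', u⟩, h⟩ ⟨r, r'⟩
    cases r' with
    | inr r' => exact ⟨⟨(s', _), h⟩, ⟨r, r'⟩, rfl⟩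

theorem post_choice (M N : ActModel P A) (K : Model P A) (s : K.W) (k : ℕ) :
    (M.choice N).post Q K s k = M.post Q K s k ∪ N.post Q K s k := by
  ext σ
  constructor
  · rintro ⟨_, ⟨t, ht, rfl⟩ | ⟨t, ht, rfl⟩, h, rfl⟩
    · exact .inl ⟨t, ht, h, (isBoundedMorphism_inl M N K).ty_eq Q k ⟨(s, t), h⟩⟩
    · exact .inr ⟨t, ht, h, (isBoundedMorphism_inr M N K).ty_eq Q k ⟨(s, t), h⟩⟩
  · rintro (⟨t, ht, h, rfl⟩ | ⟨t, ht, h, rfl⟩)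
    · exact ⟨.inl t, .inl ⟨t, ht, rfl⟩, h,
        ((isBoundedMorphism_inl M N K).ty_eq Q k ⟨(s, t), h⟩).symm⟩
    · exact ⟨.inr t, .inr ⟨t, ht, rfl⟩, h,
        ((isBoundedMorphism_inr M N K).ty_eq Q k ⟨(s, t), h⟩).symm⟩

-- Tests as guards.

section Test

variable [Nonempty P]

/-- The skip point can be executed everywhere and is related to the test point for every agent, so
no successor is lost and a test changes nothing up to bisimulation. -/
theorem isBoundedMorphism_test (χ : Form P A) (K : Model P A) :
    IsBoundedMorphism ((test χ).exec K) K fun x => x.1.1 where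
  val _ _ := Iff.rfl
  forth _ _ _ r := r.1
  back _ _ s' r := ⟨⟨(s', false), (Form.sat_ofModal _ _ _).2 ModalForm.sat_top⟩, ⟨r, trivial⟩, rfl⟩

theorem mem_post_test {χ : Form P A} {K : Model P A} {s : K.W} {k : ℕ} {σ : Ty Q A k} :
    σ ∈ (test χ).post Q K s k ↔ χ.Sat K s ∧ K.ty Q k s = σ := by
  constructor
  · rintro ⟨_, rfl, h, rfl⟩
    exact ⟨h, ((isBoundedMorphism_test χ K).ty_eq Q k ⟨(s, true), h⟩).symm⟩
  · rintro ⟨h, rfl⟩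
    exact ⟨true, rfl, h, (isBoundedMorphism_test χ K).ty_eq Q k ⟨(s, true), h⟩⟩

variable [Fintype A]

theorem sat_pre_test_seq {χ : Form P A} {M : ActModel P A} {i : Bool} {t : M.frame.pt}
    (hM : (M.pre t).RefFree) {K : Model P A} {s : K.W} :
    (((test χ).seq M).pre (i, t)).Sat K s ↔ ((test χ).pre i).Sat K s ∧ (M.pre t).Sat K s := by
  obtain ⟨m, -, hm⟩ := Form.exists_reduces hM
  have key : ∀ x : ((test χ).exec K).W,
      (M.pre t).Sat ((test χ).exec K) x ↔ (M.pre t).Sat K x.1.1 := fun x => by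
    rw [hm, hm]
    exact (isBoundedMorphism_test χ K).sat_iff m x
  constructor
  · intro h
    obtain ⟨h, h'⟩ := Form.sat_someAct_pt.1 h
    exact ⟨h, (key ⟨(s, _), h⟩).1 h'⟩
  · rintro ⟨h, h'⟩
    exact Form.sat_someAct_pt.2 ⟨h, (key ⟨(s, i), h⟩).2 h'⟩

theorem isBoundedMorphism_test_seq (χ : Form P A) {M : ActModel P A}
    (hM : ∀ t, (M.pre t).RefFree) (K : Model P A) :
    IsBoundedMorphism (((test χ).seq M).exec K) (M.exec K)
      fun x => ⟨(x.1.1, x.1.2.2), ((sat_pre_test_seq (hM _)).1 x.2).2⟩ where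
  val _ _ := Iff.rfl
  forth _ _ _ r := ⟨r.1, r.2.2⟩
  back _ _ t' r := ⟨⟨(t'.1.1, (false, t'.1.2)), (sat_pre_test_seq (hM _)).2
    ⟨(Form.sat_ofModal _ _ _).2 ModalForm.sat_top, t'.2⟩⟩, ⟨r.1, trivial, r.2⟩, rfl⟩

/-- A preceding test restricts where an action can be executed but not what it results in: after
skip, the guard plays no role at indistinguishable worlds. -/
theorem mem_post_test_seq {χ : Form P A} {M : ActModel P A} (hM : ∀ t, (M.pre t).RefFree)
    {K : Model P A} {s : K.W} {k : ℕ} {σ : Ty Q A k} :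
    σ ∈ ((test χ).seq M).post Q K s k ↔ χ.Sat K s ∧ σ ∈ M.post Q K s k := by
  have key := (isBoundedMorphism_test_seq χ hM K).ty_eq Q k
  constructor
  · rintro ⟨⟨_, t⟩, ⟨rfl, ht⟩, h, rfl⟩
    exact ⟨((sat_pre_test_seq (hM t)).1 h).1, t, ht, ((sat_pre_test_seq (hM t)).1 h).2,
      (key ⟨(s, _, t), h⟩).symm⟩
  · rintro ⟨h, t, ht, h', rfl⟩
    exact ⟨(true, t), ⟨rfl, ht⟩, (sat_pre_test_seq (hM t)).2 ⟨h, h'⟩,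
      key ⟨(s, true, t), (sat_pre_test_seq (hM t)).2 ⟨h, h'⟩⟩⟩

end Test

-- The effect of learning by a single agent.

section Learn

variable {M N : ActModel P A} {K : Model P A} {b : A} {d : ℕ} {K₀ : Model P A} {s₀ : K₀.W}

/-- A proxy point of a result of learning is sent to the point that it is the proxy of. -/
def learnBase {B : Set A} (x : ((learn B M N).exec K).W) : ((M.choice N).exec K).W :=
  ⟨(x.1.1, LearnPt.base x.1.2), x.2⟩

/-- For `c ≠ b` a proxy sits in the class of its original, and by `ih` the added proxies contribute
no new types. Original points serve as witnesses for the converse. -/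
theorem learn_snd_of_ne {k : ℕ}
    (ih : ∀ x : ((learn {b} M N).exec K).W,
      ((learn {b} M N).exec K).ty Q k x = ((M.choice N).exec K).ty Q k (learnBase x))
    {c : A} (hc : c ≠ b) (x : ((learn {b} M N).exec K).W) :
    (((learn {b} M N).exec K).ty Q (k + 1) x).2 c =
      (((M.choice N).exec K).ty Q (k + 1) (learnBase x)).2 c := by
  ext σ
  simp only [Model.mem_ty_succ]
  constructor
  · rintro ⟨y, ⟨r, ⟨hb, _⟩ | ⟨_, r'⟩⟩, rfl⟩
    · exact absurd hb hc
    · exact ⟨learnBase y, ⟨r, r'⟩, (ih y).symm⟩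
  · rintro ⟨⟨⟨s, t⟩, h⟩, ⟨r, r'⟩, rfl⟩
    exact ⟨⟨(s, .inl t), h⟩, ⟨r, .inr ⟨hc, r'⟩⟩, ih ⟨(s, .inl t), h⟩⟩

theorem learn_snd_of_inl {k : ℕ}
    (ih : ∀ x : ((learn {b} M N).exec K).W,
      ((learn {b} M N).exec K).ty Q k x = ((M.choice N).exec K).ty Q k (learnBase x))
    {s : K.W} {t : (M.choice N).frame.pt} (h : ((M.choice N).pre t).Sat K s) :
    (((learn {b} M N).exec K).ty Q (k + 1) ⟨(s, .inl t), h⟩).2 b =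
      (((M.choice N).exec K).ty Q (k + 1) ⟨(s, t), h⟩).2 b := by
  ext σ
  constructor
  · rintro ⟨⟨⟨s', y⟩, h'⟩, ⟨r, ⟨_, r'⟩ | ⟨hb, _⟩⟩, rfl⟩
    · cases r' with
      | inl r' => exact ⟨⟨(s', _), h'⟩, ⟨r, r'⟩, (ih ⟨(s', _), h'⟩).symm⟩
    · exact absurd rfl hb
  · rintro ⟨⟨⟨s', t'⟩, h'⟩, ⟨r, r'⟩, rfl⟩
    exact ⟨⟨(s', .inl t'), h'⟩, ⟨r, .inl ⟨rfl, .inl r'⟩⟩, ih ⟨(s', .inl t'), h'⟩⟩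

/-- Every result of `M` or `N` has one of the types in the class of `s₀`, and each of these types
results from `M` or `N` at some world that the agent cannot tell apart. -/
def Covers (Q : Finset P) (M N : ActModel P A) (K : Model P A) (b : A) (d : ℕ)
    (K₀ : Model P A) (s₀ : K₀.W) : Prop :=
  (∀ s, (M.choice N).post Q K s d ⊆ (K₀.ty Q (d + 1) s₀).2 b) ∧
  ∀ s, ((M.choice N).post Q K s d).Nonempty → ∀ σ ∈ (K₀.ty Q (d + 1) s₀).2 b,
    ∃ s', K.R b s s' ∧ σ ∈ (M.choice N).post Q K s' d

/-- Agent `b` sees from a proxy exactly the proxies at `b`-related worlds. The two halves of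
`Covers` say that these have no type outside the prescribed class and that no type of the class is
missing. -/
theorem learn_snd_of_inr (H : Covers Q M N K b d K₀ s₀) {k : ℕ} (hk : k ≤ d)
    (ih : ∀ x : ((learn {b} M N).exec K).W,
      ((learn {b} M N).exec K).ty Q k x = ((M.choice N).exec K).ty Q k (learnBase x))
    {s : K.W} {t : {t // t ∈ (M.choice N).pts}} (h : ((M.choice N).pre t.1).Sat K s) :
    (((learn {b} M N).exec K).ty Q (k + 1) ⟨(s, .inr t), h⟩).2 b =
      (K₀.ty Q (k + 1) s₀).2 b := by
  ext σ
  simp only [Model.mem_ty_succ]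
  constructor
  · rintro ⟨⟨⟨s', y⟩, h'⟩, ⟨r, ⟨_, r'⟩ | ⟨hb, _⟩⟩, rfl⟩
    · cases r' with
      | @inr _ y r' =>
        obtain ⟨z, rz, e⟩ := H.1 s' ⟨y.1, y.2, h', rfl⟩
        exact ⟨z, rz, (Model.ty_eq_of_le hk e).trans (ih ⟨(s', .inr y), h'⟩).symm⟩
    · exact absurd rfl hb
  · rintro ⟨z, rz, rfl⟩
    obtain ⟨s', r, t', ht', h', e⟩ := H.2 s ⟨_, t.1, t.2, h, rfl⟩ _ ⟨z, rz, rfl⟩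
    exact ⟨⟨(s', .inr ⟨t', ht'⟩), h'⟩, ⟨r, .inl ⟨rfl, .inr trivial⟩⟩,
      (ih ⟨(s', .inr ⟨t', ht'⟩), h'⟩).trans (Model.ty_eq_of_le hk e)⟩

/-- Learning is invisible up to depth `d`: the new class of a proxy agrees with the old one, because
its original already had the type of a member of the class of `s₀`. -/
theorem ty_learn (H : Covers Q M N K b d K₀ s₀) {k : ℕ} (hk : k ≤ d)
    (x : ((learn {b} M N).exec K).W) :
    ((learn {b} M N).exec K).ty Q k x = ((M.choice N).exec K).ty Q k (learnBase x) := by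
  induction k generalizing x with
  | zero => rfl
  | succ k ih =>
    have ih := ih (by omega)
    refine Prod.ext (ih x) (funext fun c => ?_)
    by_cases hc : c = b
    · subst hc
      obtain ⟨⟨s, t | t⟩, h⟩ := x
      · exact learn_snd_of_inl ih h
      -- `z` is `b`-related to `s₀` and has the depth-`d` type of the original. Truncated to depth
      -- `k + 1 ≤ d`, the original's class is that of `z`, which is that of `s₀`.
      · obtain ⟨z, rz, e⟩ := H.1 s ⟨t.1, t.2, h, rfl⟩
        refine (learn_snd_of_inr H (by omega) ih h).trans ?_
        rw [Model.ty_succ_snd_eq k rz, Model.ty_eq_of_le hk e]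
        rfl
    · exact learn_snd_of_ne ih hc x

-- Depth `d + 1` is the first depth at which learning shows: the class of `b` is overwritten and
-- nothing else changes, so earlier agents keep the classes given to them.
open Classical in
theorem post_learn (H : Covers Q M N K b d K₀ s₀) (s : K.W) :
    (learn {b} M N).post Q K s (d + 1) =
      (fun τ : Ty Q A (d + 1) =>
        ((τ.1, Function.update τ.2 b ((K₀.ty Q (d + 1) s₀).2 b)) : Ty Q A (d + 1))) ''
        M.post Q K s (d + 1) := by
  have ih := fun x => ty_learn (k := d) H le_rfl x
  have key : ∀ (t : M.frame.pt) (ht : t ∈ M.pts) (h : (M.pre t).Sat K s),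
      ((learn {b} M N).exec K).ty Q (d + 1)
        ⟨(s, .inr ⟨.inl t, Or.inl (Set.mem_image_of_mem Sum.inl ht)⟩), h⟩ =
      (((M.exec K).ty Q (d + 1) ⟨(s, t), h⟩).1,
        Function.update ((M.exec K).ty Q (d + 1) ⟨(s, t), h⟩).2 b
          ((K₀.ty Q (d + 1) s₀).2 b)) := by
    intro t ht h
    rw [(isBoundedMorphism_inl M N K).ty_eq Q (d + 1) ⟨(s, t), h⟩]
    refine Prod.ext (ih _) (funext fun c => ?_)
    by_cases hc : c = b
    · subst hc
      simp only [Function.update_self]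
      exact learn_snd_of_inr (t := ⟨.inl t, Or.inl (Set.mem_image_of_mem Sum.inl ht)⟩) H le_rfl ih h
    · simp only [Function.update_of_ne hc]
      exact learn_snd_of_ne ih hc _
  ext σ
  constructor
  · rintro ⟨_, ⟨t, ht, rfl⟩, h, rfl⟩
    exact ⟨_, ⟨t, ht, h, rfl⟩, (key t ht h).symm⟩
  · rintro ⟨_, ⟨t, ht, h, rfl⟩, rfl⟩
    exact ⟨_, ⟨t, ht, rfl⟩, h, key t ht h⟩

end Learn

end ActModel

/-! ## Synthesis of action formulae -/

namespace Form

variable {P : Type u} {A : Type v}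

theorem refFree_top [Nonempty P] : (top : Form P A).RefFree := ⟨trivial, trivial⟩

theorem refFree_bigAnd [Nonempty P] {ι : Type*} {s : Finset ι} {f : ι → Form P A}
    (h : ∀ i ∈ s, (f i).RefFree) : (bigAnd s f).RefFree := by
  simp only [bigAnd, ← Finset.mem_toList (s := s)] at h ⊢
  generalize s.toList = l at h
  induction l with
  | nil => exact refFree_top
  | cons i l ih => exact ⟨h i (by simp), ih fun j hj => h j (by simp [hj])⟩

theorem sat_bigAnd [Nonempty P] {ι : Type*} {I : Finset ι} {f : ι → Form P A}
    {K : Model P A} {s : K.W} : (bigAnd I f).Sat K s ↔ ∀ i ∈ I, (f i).Sat K s := by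
  simp only [bigAnd, ← Finset.mem_toList (s := I)]
  induction I.toList with
  | nil => exact iff_of_true ((sat_ofModal _ K s).2 ModalForm.sat_top) (by simp)
  | cons i l ih => simp [Sat, ih]

theorem sat_dia {a : A} {φ : Form P A} {K : Model P A} {s : K.W} :
    (dia a φ).Sat K s ↔ ∃ s', K.R a s s' ∧ φ.Sat K s' := by
  simp [dia, Sat]

theorem sat_someAct_chr [Nonempty P] [Fintype A] {Q : Finset P} {M : ActModel P A} {k : ℕ}
    {τ : Ty Q A k} {K : Model P A} {s : K.W} :
    (someAct M (ofModal (Ty.chr k τ))).Sat K s ↔ τ ∈ M.post Q K s k := by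
  rw [sat_someAct]
  exact exists_congr fun t => and_congr_right fun _ => exists_congr fun h =>
    (sat_ofModal _ _ _).trans Ty.sat_chr

end Form

/-- The inclusion of the modal language in arbitrary action formula logic. -/
def AFForm.ofModal {P : Type u} {A : Type v} : ModalForm P A → AFForm P A
  | .atom p => .atom p
  | .neg φ => .neg (ofModal φ)
  | .and φ ψ => .and (ofModal φ) (ofModal ψ)
  | .box a φ => .box a (ofModal φ)

theorem AFForm.refFree_ofModal {P : Type u} {A : Type v} (m : ModalForm P A) :
    (AFForm.ofModal m).RefFree := by
  induction m with
  | atom p => simp [ofModal, RefFree]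
  | neg φ ih => simpa [ofModal, RefFree]
  | and φ ψ ih ih' => simpa [ofModal, RefFree] using ⟨ih, ih'⟩
  | box a φ ih => simpa [ofModal, RefFree]

section

variable {P : Type u} {A : Type v} [Nonempty P]

theorem AFForm.toForm_ofModal (m : ModalForm P A) :
    (AFForm.ofModal m).toForm = Form.ofModal m := by
  induction m with
  | atom p => rw [ofModal, toForm, Form.ofModal]
  | neg φ ih => rw [ofModal, toForm, Form.ofModal, ih]
  | and φ ψ ih ih' => rw [ofModal, toForm, Form.ofModal, ih, ih']
  | box a φ ih => rw [ofModal, toForm, Form.ofModal, ih]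

mutual

theorem AFForm.refFree_toForm : (φ : AFForm P A) → φ.RefFree → φ.toForm.RefFree
  | .atom _, _ => by
    rw [AFForm.toForm]
    trivial
  | .neg φ, h => by
    rw [AFForm.RefFree] at h
    rw [AFForm.toForm]
    exact AFForm.refFree_toForm φ h
  | .and φ ψ, h => by
    rw [AFForm.RefFree] at h
    rw [AFForm.toForm]
    exact ⟨AFForm.refFree_toForm φ h.1, AFForm.refFree_toForm ψ h.2⟩
  | .box _ φ, h => by
    rw [AFForm.RefFree] at h
    rw [AFForm.toForm]
    exact AFForm.refFree_toForm φ h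
  | .allAct α φ, h => by
    rw [AFForm.RefFree] at h
    rw [AFForm.toForm]
    exact ⟨AFAct.refFree_pre α h.1, AFForm.refFree_toForm φ h.2⟩
  | .allRef _, h => by
    rw [AFForm.RefFree] at h
    exact h.elim

theorem AFAct.refFree_pre :
    (α : AFAct P A) → α.RefFree → ∀ t : α.toModel.frame.pt, (α.toModel.pre t).RefFree
  | .test φ, h => by
    rw [AFAct.RefFree] at h
    rw [AFAct.toModel]
    rintro (_ | _)
    · exact Form.refFree_top
    · exact AFForm.refFree_toForm φ h
  | .choice α β, h => by
    rw [AFAct.RefFree] at h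
    rw [AFAct.toModel]
    rintro (t | t)
    · exact AFAct.refFree_pre α h.1 t
    · exact AFAct.refFree_pre β h.2 t
  | .seq α β, h => by
    rw [AFAct.RefFree] at h
    rw [AFAct.toModel]
    exact fun t => ⟨AFAct.refFree_pre α h.1, AFAct.refFree_pre β h.2 t.2⟩
  | .learn _ _ α β, h => by
    rw [AFAct.RefFree] at h
    rw [AFAct.toModel]
    rintro ((t | t) | ⟨t | t, _⟩)
    · exact AFAct.refFree_pre α h.1 t
    · exact AFAct.refFree_pre β h.2 t
    · exact AFAct.refFree_pre α h.1 t
    · exact AFAct.refFree_pre β h.2 t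

end

end

namespace AFAct

variable {P : Type u} {A : Type v} [Nonempty P] {Q : Finset P}

/-- The types of the results of executing an action formula. -/
abbrev post (Q : Finset P) (α : AFAct P A) (K : Model P A) (s : K.W) (k : ℕ) :
    Set (Ty Q A k) := α.toModel.post Q K s k

theorem exists_choice {ι : Type*} (I : Finset ι) (f : ι → AFAct P A)
    (hf : ∀ i ∈ I, (f i).RefFree) : ∃ β : AFAct P A, β.RefFree ∧
      ∀ K s k σ, σ ∈ β.post Q K s k ↔ ∃ i ∈ I, σ ∈ (f i).post Q K s k := by
  classical
  induction I using Finset.induction_on with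
  | empty =>
    -- The empty choice is the test of falsum, which can never be executed.
    refine ⟨.test (.ofModal .bot), ?_, fun K s k σ => ?_⟩
    · rw [RefFree]
      exact AFForm.refFree_ofModal _
    · rw [post, toModel, ActModel.mem_post_test, AFForm.toForm_ofModal, Form.sat_ofModal]
      simp [ModalForm.bot, ModalForm.Sat, ModalForm.sat_top]
  | insert i I _ ih =>
    obtain ⟨β, hβ, h⟩ := ih fun j hj => hf j (by simp [hj])
    refine ⟨.choice (f i) β, ?_, fun K s k σ => ?_⟩
    · rw [RefFree]
      exact ⟨hf i (by simp), hβ⟩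
    · rw [post, toModel, ActModel.post_choice, Set.mem_union, h]
      simp

variable [Fintype A]

/-- `χ` lies in the language with arbitrary action models, whereas a test in an action formula needs
a formula of `AFForm`; the modal equivalent of `χ` is one. -/
theorem exists_test_seq {χ : Form P A} (hχ : χ.RefFree) {α : AFAct P A} (hα : α.RefFree) :
    ∃ β : AFAct P A, β.RefFree ∧
      ∀ K s k σ, σ ∈ β.post Q K s k ↔ χ.Sat K s ∧ σ ∈ α.post Q K s k := by
  obtain ⟨m, -, hm⟩ := Form.exists_reduces hχ
  refine ⟨.seq (.test (.ofModal m)) α, ?_, fun K s k σ => ?_⟩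
  · rw [RefFree, RefFree]
    exact ⟨AFForm.refFree_ofModal m, hα⟩
  · rw [post, toModel, toModel, ActModel.mem_post_test_seq (refFree_pre α hα),
      AFForm.toForm_ofModal, Form.sat_ofModal, hm]

/-- `α` always results in the type `τ`, and it provably can be executed if some refinement
has the type `τ`. -/
structure Synthesises {k : ℕ} (α : AFAct P A) (τ : Ty Q A k) : Prop where
  refFree : α.RefFree
  eq_of_mem : ∀ {K s σ}, σ ∈ α.post Q K s k → σ = τ
  provable : Provable (Form.imp (Form.someRef (Form.ofModal (Ty.chr k τ)))
    (Form.someAct α.toModel (Form.ofModal (Ty.chr k τ))))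

theorem synthesises_zero (τ : Ty Q A 0) :
    (AFAct.test (.ofModal (Ty.chr 0 τ))).Synthesises τ := by
  have mem : ∀ {K s σ}, σ ∈ (AFAct.test (.ofModal (Ty.chr 0 τ))).post Q K s 0 ↔
      K.ty Q 0 s = τ ∧ K.ty Q 0 s = σ := fun {K s σ} => by
    rw [post, toModel, ActModel.mem_post_test, AFForm.toForm_ofModal, Form.sat_ofModal,
      Ty.sat_chr]
  have hr : (AFAct.test (.ofModal (Ty.chr 0 τ))).RefFree := by
    rw [RefFree]
    exact AFForm.refFree_ofModal _
  refine ⟨hr, fun h => (mem.1 h).2.symm.trans (mem.1 h).1, ?_⟩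
  have h : Provable (Form.imp (Form.someRef (Form.ofModal (Ty.chr 0 τ)))
      (Form.ofModal (Ty.chr 0 τ))) := by
    -- `axRP` speaks of `∀`; on the negation it gives that `∃` of the characteristic formula implies
    -- the formula itself.
    have hp : (Form.neg (Form.ofModal (Ty.chr 0 τ))).IsProp := Ty.isProp_chr_zero τ
    refine (Provable.axRP hp).conseq fun v hv => ?_
    simp only [Form.someRef, hv.iff, hv.imp, hv.neg]
    tauto
  refine h.trans (.of_valid ⟨Form.refFree_ofModal _, refFree_pre _ hr,
    Form.refFree_ofModal _⟩ fun K s => ?_)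
  rw [Form.sat_imp, Form.sat_someAct_chr, Form.sat_ofModal, Ty.sat_chr]
  exact fun e => mem.2 ⟨e, e⟩

/-- The formula that says that every type in `S` results from its action formula at some world
that `b` cannot tell apart. -/
noncomputable def reach {k : ℕ} (f : Ty Q A k → AFAct P A) (b : A) (S : Set (Ty Q A k)) :
    Form P A :=
  Form.bigAnd (Set.toFinite S).toFinset fun σ =>
    Form.dia b (Form.someAct (f σ).toModel (Form.ofModal (Ty.chr k σ)))

theorem sat_reach {k : ℕ} {f : Ty Q A k → AFAct P A} {b : A} {S : Set (Ty Q A k)}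
    {K : Model P A} {s : K.W} : (reach f b S).Sat K s ↔
      ∀ σ ∈ S, ∃ s', K.R b s s' ∧ σ ∈ (f σ).post Q K s' k := by
  simp only [reach, Form.sat_bigAnd, Form.sat_dia, Form.sat_someAct_chr,
    Set.Finite.mem_toFinset]

/-- The guard is constant on classes of `b`, so it still holds at the worlds where the members of
the class are produced. -/
theorem sat_reach_congr {k : ℕ} {f : Ty Q A k → AFAct P A} {b : A} {S : Set (Ty Q A k)}
    {K : Model P A} {s s' : K.W} (r : K.R b s s') (h : (reach f b S).Sat K s) :
    (reach f b S).Sat K s' := by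
  rw [sat_reach] at h ⊢
  intro σ hσ
  obtain ⟨t, rt, ht⟩ := h σ hσ
  exact ⟨t, (K.equiv b).trans ((K.equiv b).symm r) rt, ht⟩

theorem refFree_reach {k : ℕ} {f : Ty Q A k → AFAct P A} {b : A} {S : Set (Ty Q A k)}
    (hf : ∀ σ ∈ S, (f σ).RefFree) : (reach f b S).RefFree :=
  Form.refFree_bigAnd fun σ hσ =>
    ⟨refFree_pre _ (hf σ ((Set.Finite.mem_toFinset _).1 hσ)), Form.refFree_ofModal _⟩

/-- An action formula whose results have prescribed classes for the agents in `S`. -/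
theorem exists_learn {k : ℕ} {K₀ : Model P A} (s₀ : K₀.W) {f : Ty Q A k → AFAct P A}
    (hf : ∀ s, (f (K₀.ty Q k s)).Synthesises (K₀.ty Q k s)) (S : Finset A) :
    ∃ α : AFAct P A, α.RefFree ∧
      (∀ K s, ∀ τ ∈ α.post Q K s (k + 1), τ.1 = K₀.ty Q k s₀ ∧
        ∀ a ∈ S, τ.2 a = (K₀.ty Q (k + 1) s₀).2 a) ∧
      ∀ (K : Model P A) (s : K.W),
        K₀.ty Q k s₀ ∈ (f (K₀.ty Q k s₀)).post Q K s k →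
        (∀ a ∈ S, (reach f a ((K₀.ty Q (k + 1) s₀).2 a)).Sat K s) →
        (α.post Q K s (k + 1)).Nonempty := by
  classical
  induction S using Finset.induction_on with
  | empty =>
    -- With no agent treated yet, only the depth-`k` part is prescribed. Whether a result exists
    -- does not depend on the depth at which it is typed.
    refine ⟨f (K₀.ty Q k s₀), (hf s₀).refFree, fun K s τ hτ => ⟨?_, by simp⟩, fun K s h _ => ?_⟩
    · exact (hf s₀).eq_of_mem (ActModel.mem_post_succ_fst hτ)
    · exact ActModel.post_nonempty_iff.2 (ActModel.post_nonempty_iff.1 ⟨_, h⟩)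
  | insert b S _ ih =>
    obtain ⟨α, hα, hpost, hne⟩ := ih
    have hS : ∀ σ ∈ (K₀.ty Q (k + 1) s₀).2 b, (f σ).Synthesises σ := by
      rintro _ ⟨s, _, rfl⟩
      exact hf s
    have hχ : (reach f b ((K₀.ty Q (k + 1) s₀).2 b)).RefFree :=
      refFree_reach fun σ hσ => (hS σ hσ).refFree
    -- `β` is the alternative offered to `b`: any action that produces a member of the prescribed
    -- class.
    obtain ⟨β, hβ, memβ⟩ := exists_choice (Q := Q)
      (Set.toFinite ((K₀.ty Q (k + 1) s₀).2 b)).toFinset f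
      fun σ hσ => (hS σ ((Set.Finite.mem_toFinset _).1 hσ)).refFree
    simp only [Set.Finite.mem_toFinset] at memβ
    obtain ⟨α', hα', memα'⟩ := exists_test_seq (Q := Q) hχ hα
    obtain ⟨β', hβ', memβ'⟩ := exists_test_seq (Q := Q) hχ hβ
    have mem : ∀ K s k' σ, σ ∈ (α'.toModel.choice β'.toModel).post Q K s k' ↔
        (reach f b ((K₀.ty Q (k + 1) s₀).2 b)).Sat K s ∧
          (σ ∈ α.post Q K s k' ∨
            ∃ σ' ∈ (K₀.ty Q (k + 1) s₀).2 b, σ ∈ (f σ').post Q K s k') := by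
      intro K s k' σ
      rw [ActModel.post_choice, Set.mem_union, memα', memβ', memβ, and_or_left]
    -- Results lie in the class by `hpost` and `hS`. Executability of either alternative entails the
    -- guard, which supplies every member of the class at a related world.
    have H : ∀ K, ActModel.Covers Q α'.toModel β'.toModel K b k K₀ s₀ := by
      refine fun K => ⟨fun s σ hσ => ?_, fun s ⟨σ', hσ'⟩ σ hσ => ?_⟩
      · obtain ⟨_, ⟨t, ht, h, rfl⟩ | ⟨σ', hσ', h⟩⟩ := (mem _ _ _ _).1 hσ
        · exact ⟨s₀, (K₀.equiv b).refl s₀, (hpost K s _ ⟨t, ht, h, rfl⟩).1.symm⟩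
        · rw [(hS σ' hσ').eq_of_mem h]
          exact hσ'
      · have h := ((mem _ _ _ _).1 hσ').1
        obtain ⟨s', r, h'⟩ := sat_reach.1 h σ hσ
        exact ⟨s', r, (mem _ _ _ _).2 ⟨sat_reach_congr r h, .inr ⟨σ, hσ, h'⟩⟩⟩
    refine ⟨.learn {b} (Set.singleton_nonempty b) α' β', ?_, fun K s τ hτ => ?_,
      fun K s h h' => ?_⟩
    · rw [RefFree]
      exact ⟨hα', hβ'⟩
    · rw [post, toModel, ActModel.post_learn (H K)] at hτ
      obtain ⟨τ, hτ, rfl⟩ := hτ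
      obtain ⟨h, h'⟩ := hpost K s τ ((memα' _ _ _ _).1 hτ).2
      refine ⟨h, fun a ha => ?_⟩
      by_cases hab : a = b
      · subst hab
        simp only [Function.update_self]
      · simp only [Function.update_of_ne hab]
        exact h' a ((Finset.mem_insert.1 ha).resolve_left hab)
    · rw [post, toModel, ActModel.post_learn (H K)]
      refine Set.Nonempty.image _ ?_
      obtain ⟨τ, hτ⟩ := hne K s h fun a ha => h' a (Finset.mem_insert_of_mem ha)
      exact ⟨τ, (memα' _ _ _ _).2 ⟨h' b (Finset.mem_insert_self b S), hτ⟩⟩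

/-- The cover axioms enter here. `axRDist` splits the formula by agents, `axRS5` moves `∃` below the
diamonds, and `hf` replaces each `∃` by an execution of the corresponding action. -/
theorem provable_someRef_chr_succ [Nonempty A] (hQ : Classical.arbitrary P ∈ Q) {k : ℕ}
    {K₀ : Model P A} (s₀ : K₀.W) {f : Ty Q A k → AFAct P A}
    (hf : ∀ s, (f (K₀.ty Q k s)).Synthesises (K₀.ty Q k s)) :
    Provable (Form.imp (Form.someRef (Form.ofModal (Ty.chr (k + 1) (K₀.ty Q (k + 1) s₀))))
      (Form.and (Form.someAct (f (K₀.ty Q k s₀)).toModel (Form.ofModal (Ty.chr k (K₀.ty Q k s₀))))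
        (Form.bigAnd Finset.univ fun a => reach f a ((K₀.ty Q (k + 1) s₀).2 a)))) := by
  have hE := Ty.explicit_chr hQ (k := k) s₀
  have hD := Provable.axRDist _ _ hE
  have hS : ∀ a ∈ Finset.univ, Provable (Form.iff _ _) := fun a _ =>
    Provable.axRS5 a _ _ (hE.mono (Set.subset_univ {a}))
  have hR : ∀ a ∈ Finset.univ, Provable (Form.imp
      (Form.bigAnd (Ty.chrs ((K₀.ty Q (k + 1) s₀).2 a)) fun γ =>
        Form.dia a (Form.someRef (Form.ofModal γ)))
      (reach f a ((K₀.ty Q (k + 1) s₀).2 a))) := by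
    intro a _
    have : ∀ σ ∈ (Set.toFinite ((K₀.ty Q (k + 1) s₀).2 a)).toFinset, Provable (Form.imp
        (Form.dia a (Form.someRef (Form.ofModal (Ty.chr k σ))))
        (Form.dia a (Form.someAct (f σ).toModel (Form.ofModal (Ty.chr k σ))))) := by
      intro σ hσ
      obtain ⟨s, _, rfl⟩ := (Set.Finite.mem_toFinset _).1 hσ
      exact (hf s).provable.dia_imp a
    refine (Provable.bigAnd this).conseq fun v hv => ?_
    simp only [reach, hv.imp, hv.bigAnd]
    exact fun h h' σ hσ =>
      h σ hσ (h' _ (Ty.mem_chrs.2 ⟨σ, (Set.Finite.mem_toFinset _).1 hσ, rfl⟩))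
  have e : Form.ofModal (Ty.chr (k + 1) (K₀.ty Q (k + 1) s₀)) =
      Form.and (Form.ofModal (Ty.chr k (K₀.ty Q k s₀)))
        (Form.bigAnd Finset.univ fun a => Form.cover a (Ty.chrs ((K₀.ty Q (k + 1) s₀).2 a))) := by
    simp only [Ty.chr_succ, Form.ofModal, Form.ofModal_bigAnd, Form.ofModal_cover]
    rfl
  rw [e]
  refine (hD.conj ((Provable.bigAnd hS).conj ((Provable.bigAnd hR).conj
    (hf s₀).provable))).conseq fun v hv => ?_
  simp only [hv.imp, hv.iff, hv.and, hv.bigAnd, Finset.mem_univ, forall_const]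
  rintro ⟨h₁, h₂, h₃, h₄⟩ h
  have h₅ := fun a => (h₂ a).1 (h₁.1 h a)
  -- The conjunct `∃γ⁰` is read off the axiom of some agent, so there must be at least one.
  exact ⟨h₄ (h₅ (Classical.arbitrary A)).1, fun a => h₃ a (h₅ a).2⟩

/-- Only realised types are synthesised. The model stays fixed while the world varies, since the
types in the classes are realised in the same model. -/
theorem exists_synthesises [Nonempty A] (hQ : Classical.arbitrary P ∈ Q) (k : ℕ)
    (K₀ : Model P A) (s₀ : K₀.W) : ∃ α : AFAct P A, α.Synthesises (K₀.ty Q k s₀) := by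
  induction k generalizing s₀ with
  | zero => exact ⟨_, synthesises_zero _⟩
  | succ k ih =>
    obtain ⟨f, hf⟩ : ∃ f : Ty Q A k → AFAct P A,
        ∀ s, (f (K₀.ty Q k s)).Synthesises (K₀.ty Q k s) := by
      classical
      -- `f` is total for convenience; its value at types not realised in `K₀` is arbitrary.
      have : ∀ σ : Ty Q A k, ∃ α : AFAct P A, (∃ s, K₀.ty Q k s = σ) → α.Synthesises σ := by
        intro σ
        by_cases h : ∃ s, K₀.ty Q k s = σ
        · obtain ⟨s, rfl⟩ := h
          exact (ih s).imp fun α hα _ => hα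
        · exact (ih s₀).imp fun α _ h' => absurd h' h
      choose f hf using this
      exact ⟨f, fun s => hf _ ⟨s, rfl⟩⟩
    obtain ⟨α, hα, hpost, hne⟩ := exists_learn s₀ hf Finset.univ
    have eq_of_mem : ∀ {K s σ}, σ ∈ α.post Q K s (k + 1) → σ = K₀.ty Q (k + 1) s₀ :=
      fun {K s σ} h => Prod.ext (hpost K s σ h).1
        (funext fun a => (hpost K s σ h).2 a (Finset.mem_univ a))
    refine ⟨α, hα, eq_of_mem, (provable_someRef_chr_succ hQ s₀ hf).trans (.of_valid ?_ ?_)⟩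
    · refine ⟨⟨⟨refFree_pre _ (hf s₀).refFree, Form.refFree_ofModal _⟩,
        Form.refFree_bigAnd fun a _ => refFree_reach ?_⟩,
        refFree_pre _ hα, Form.refFree_ofModal _⟩
      rintro _ ⟨s, _, rfl⟩
      exact (hf s).refFree
    · intro K s
      rw [Form.sat_imp, Form.sat_someAct_chr]
      rintro ⟨h, h'⟩
      obtain ⟨σ, hσ⟩ := hne K s (Form.sat_someAct_chr.1 h) (Form.sat_bigAnd.1 h')
      rwa [← eq_of_mem hσ]

end AFAct

theorem exists_action {P : Type u} {A : Type v} [Nonempty P] [Fintype A] [Nonempty A]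
    {φ : Form P A} (hφ : φ.RefFree) : ∃ α : AFAct P A, α.RefFree ∧
      Provable (Form.allAct α.toModel φ) ∧
      Provable (Form.imp (Form.someRef φ) (Form.someAct α.toModel φ)) := by
  classical
  obtain ⟨m, -, hm⟩ := Form.exists_reduces hφ
  -- `Q` must contain the atom from which truth and falsum are built, since these occur in
  -- characteristic formulae.
  obtain ⟨Q, k, hQ, hb⟩ := m.exists_bdd {Classical.arbitrary P}
  have hQ := hQ (Finset.mem_singleton_self _)
  -- Truth of `φ` depends only on the type, so `φ` is equivalent to the disjunction of the
  -- characteristic formulae of `I`.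
  let I : Set (Ty Q A k) := {σ | ∃ (K : Model P A) (s : K.W), K.ty Q k s = σ ∧ m.Sat K s}
  have hI : ∀ {K : Model P A} {s : K.W}, K.ty Q k s ∈ I ↔ φ.Sat K s := fun {K s} => by
    rw [hm]
    exact ⟨fun ⟨K', s', e, h⟩ => (hb.sat_iff e).1 h, fun h => ⟨K, s, rfl, h⟩⟩
  have : ∀ σ : Ty Q A k, ∃ α : AFAct P A, σ ∈ I → α.Synthesises σ := by
    intro σ
    by_cases h : σ ∈ I
    · obtain ⟨K, s, rfl, -⟩ := h
      exact (AFAct.exists_synthesises hQ k K s).imp fun α hα _ => hα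
    · exact ⟨.test (.ofModal .top), fun h' => absurd h' h⟩
  choose f hf using this
  have memI : ∀ {σ}, σ ∈ (Set.toFinite I).toFinset ↔ σ ∈ I := Set.Finite.mem_toFinset _
  obtain ⟨β, hβ, memβ⟩ := AFAct.exists_choice (Q := Q) (Set.toFinite I).toFinset f
    fun σ hσ => (hf σ (memI.1 hσ)).refFree
  have hβI : ∀ {K s σ}, σ ∈ β.post Q K s k → σ ∈ I := fun {K s σ} h => by
    obtain ⟨σ', hσ', h⟩ := (memβ _ _ _ _).1 h
    rw [(hf σ' (memI.1 hσ')).eq_of_mem h]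
    exact memI.1 hσ'
  refine ⟨β, hβ, .of_valid ⟨AFAct.refFree_pre β hβ, hφ⟩ fun K s => ?_, ?_⟩
  · exact Form.sat_allAct.2 fun t ht h => hI.1 (hβI ⟨t, ht, h, rfl⟩)
  · have h₁ : Provable (Form.imp φ
        (Form.bigOr (Set.toFinite I).toFinset fun σ => Form.ofModal (Ty.chr k σ))) := by
      rw [← Form.ofModal_bigOr]
      refine .of_valid ⟨hφ, Form.refFree_ofModal _⟩ fun K s => ?_
      rw [Form.sat_imp, Form.sat_ofModal, ModalForm.sat_bigOr]
      exact fun h => ⟨_, memI.2 (hI.2 h), Ty.sat_chr.2 rfl⟩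
    have h₂ : ∀ σ ∈ (Set.toFinite I).toFinset, Provable (Form.imp
        (Form.someRef (Form.ofModal (Ty.chr k σ))) (Form.someAct β.toModel φ)) := by
      intro σ hσ
      have hσ' := hf σ (memI.1 hσ)
      refine hσ'.provable.trans (.of_valid ⟨⟨AFAct.refFree_pre _ hσ'.refFree,
        Form.refFree_ofModal _⟩, AFAct.refFree_pre β hβ, hφ⟩ fun K s => ?_)
      rw [Form.sat_imp, Form.sat_someAct_chr, Form.sat_someAct]
      intro h
      obtain ⟨t, ht, h, e⟩ := (memβ _ _ _ _).2 ⟨σ, hσ, h⟩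
      exact ⟨t, ht, h, hI.1 (e ▸ memI.1 hσ)⟩
    refine ((h₁.someRef_imp.trans (Provable.someRef_bigOr _ _)).conj
      (Provable.bigAnd h₂)).conseq fun v hv => ?_
    simp only [hv.imp, hv.and, hv.bigAnd, hv.bigOr]
    rintro ⟨h, h'⟩ k
    obtain ⟨σ, hσ, h⟩ := h k
    exact h' σ hσ h

end AFL

theorem mainTheorem6 {P : Type u} {A : Type v} [Nonempty P] [Fintype A] [Nonempty A]
    (φ : AFL.AFForm P A) (hφ : φ.RefFree) :
    ∃ α : AFL.AFAct P A, α.RefFree ∧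
      (AFL.AFForm.allAct α φ).Proves ∧
      ((AFL.AFForm.someRef φ).imp (AFL.AFForm.someAct α φ)).Proves := by
  obtain ⟨α, hα, h, h'⟩ := AFL.exists_action (AFL.AFForm.refFree_toForm φ hφ)
  refine ⟨α, hα, ?_, ?_⟩
  · rw [AFL.AFForm.Proves, AFL.AFForm.toForm]
    exact h
  · simp only [AFL.AFForm.Proves, AFL.AFForm.imp, AFL.AFForm.someRef, AFL.AFForm.someAct,
      AFL.AFForm.toForm]
    exact h'
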